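/- **Setting.** For a measurable space $(\mathsf X,\mathcal B)$ let $L_b(\mathcal B)$ be the space of bounded measurable real functions on it. A *sublinear expectation* on $L_b(\mathcal B)$ is a functional $E:L_b(\mathcal B)\to\mathbb R$ that is monotone, preserves constants, is subadditive and positively homogeneous; as usual, it is understood to be represented as $E[\varphi]=\sup_{P\in\mathcal P}E_P[\varphi]$ by some family $\mathcal P$ of ($\sigma$-additive) probability measures. A property holds *$E$-almost surely* if it holds outside a measurable set $N$ with $E[I_N]=0$. Let $d\ge 0$. A *sublinear Markov semigroup* is a family of maps $T_t:L_b(\mathcal B(\mathbb R^d))\to L_b(\mathcal B(\mathbb R^d))$, $t\ge0$, such that $\varphi\mapsto T_t[\varphi](x)$ is a sublinear expectation for all $t,x$, $T_0\varphi=\varphi$, and $T_tT_s=T_{t+s}$. It is understood that its finite-dimensional distributions are well defined, i.e. for all $k\ge1$, $t\ge 0$ and bounded Borel $\varphi$ on $(\mathbb R^d)^{k+1}$ the function $(x_1,\dots,x_k)\mapsto T_t[\varphi(x_1,\dots,x_k,\cdot)](x_k)$ is Borel. An *invariant expectation* of $T_t$ is a sublinear expectation $\tilde T$ on $L_b(\mathcal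 B(\mathbb R^d))$ with $\tilde T[T_s\varphi]=\tilde T[\varphi]$ for all $s\ge0$ and all $\varphi\in L_b(\mathcal B(\mathbb R^d))$. **Canonical dynamical system.** Let $\hat\Omega=(\mathbb R^d)^{\mathbb R}$ with its cylinder $\sigma$-algebra $\hat{\mathcal F}$, $\hat X(t)(\hat\omega)=\hat\omega(t)$ and $(\hat\theta_t\hat\omega)(s)=\hat\omega(t+s)$ for $s,t\in\mathbb R$. On cylinder functions the canonical expectation $\hat{\mathbb E}$ is given, for $t_1<\dots<t_m$ and bounded Borel $\varphi$ on $(\mathbb R^d)^m$, by $$\hat{\mathbb E}[\varphi(\hat\omega(t_1),\dots,\hat\omega(t_m))]=\tilde T[\varphi_{m-1}],$$ where $\varphi_0=\varphi$ and $$\varphi_i(x_1,\dots,x_{m-i})=T_{t_{m-i+1}-t_{m-i}}[\varphi_{i-1}(x_1,\dots,x_{m-i},\cdot)](x_{m-i}).$$ For other bounded $\hat{\mathcal F}$-measurable $\xi$, $\hat{\mathbb E}[\xi]=\sup_P E_P[\xi]$ over all probability measures $P$ on $\hat{\mathcal F}$ with $E_P\le\hat{\mathbb E}$ on cylinder functions.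 A set $A\in\hat{\mathcal F}$ is *invariant* if for every $t\in\mathbb R$, $I_A\circ\hat\theta_t=I_A$ quasi-surely, i.e. outside a set $N\in\hat{\mathcal F}$ with $\hat{\mathbb E}[I_N]=0$. The invariant expectation $\tilde T$ is *ergodic* if every invariant $A$ satisfies $\hat{\mathbb E}[I_A]=0$ or $\hat{\mathbb E}[I_{A^c}]=0$. **Theorem.** Let $\tilde T$ be an invariant expectation of the sublinear Markov semigroup $T_t$. Assume that for every $\varphi\in L_b(\mathcal B(\mathbb R^d))$ the variable $|\varphi(\hat X(0))|^2$ has no mean-uncertainty, i.e. $\hat{\mathbb E}[|\varphi(\hat X(0))|^2]=-\hat{\mathbb E}[-|\varphi(\hat X(0))|^2]$. Then $\tilde T$ is ergodic if and only if the following holds: whenever $\varphi\in L_b(\mathcal B(\mathbb R^d))$ satisfies, for every $t\ge0$, $T_t\varphi=\varphi$ and $T_t(-\varphi)=-\varphi$ $\tilde T$-almost surely, then $\varphi$ is $\tilde T$-almost surely equal to a constant. -/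

import Mathlib

open MeasureTheory
open scoped NNReal

noncomputable section

namespace SublinearErgodic

/-- `L_b`: bounded measurable real-valued functions. -/
def IsLb {α : Type*} [MeasurableSpace α] (f : α → ℝ) : Prop :=
  Measurable f ∧ ∃ C : ℝ, ∀ x, |f x| ≤ C

/-- A sublinear expectation on `L_b(α)`; values of `E` outside `L_b(α)` are irrelevant. -/
structure IsSublinearExpectation {α : Type*} [MeasurableSpace α] (E : (α → ℝ) → ℝ) : Prop where
  mono : ∀ f g, IsLb f → IsLb g → (∀ x, g x ≤ f x) → E g ≤ E f
  const : ∀ c : ℝ, E (fun _ => c) = c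
  subadd : ∀ f g, IsLb f → IsLb g → E (fun x => f x + g x) ≤ E f + E g
  homog : ∀ (r : ℝ) (f), 0 ≤ r → IsLb f → E (fun x => r * f x) = r * E f

/-- `E[φ] = sup_{P ∈ S} E_P[φ]` on `L_b(α)`, for some set `S` of (countably additive)
probability measures. As `E φ` is a real least upper bound, `S` is nonempty. -/
def IsUpperExpectation {α : Type*} [MeasurableSpace α] (E : (α → ℝ) → ℝ) : Prop :=
  ∃ S : Set (ProbabilityMeasure α), ∀ φ : α → ℝ, IsLb φ →
    IsLUB ((fun P : ProbabilityMeasure α => ∫ x, φ x ∂(P : Measure α)) '' S) (E φ)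

/-- `p` holds outside a measurable set `N` with `E[I_N] = 0`. -/
def HoldsAS {α : Type*} [MeasurableSpace α] (E : (α → ℝ) → ℝ) (p : α → Prop) : Prop :=
  ∃ N : Set α, MeasurableSet N ∧ E (N.indicator (fun _ => 1)) = 0 ∧ ∀ x, x ∉ N → p x

/-- A sublinear Markov semigroup `T_t : L_b(X) → L_b(X)`, `t ≥ 0`. -/
structure IsSublinearMarkovSemigroup {X : Type*} [MeasurableSpace X]
    (T : ℝ≥0 → (X → ℝ) → X → ℝ) : Prop where
  maps : ∀ t φ, IsLb φ → IsLb (T t φ)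
  sublinear : ∀ t x, IsSublinearExpectation (fun φ => T t φ x)
  zero : ∀ φ, IsLb φ → T 0 φ = φ
  comp : ∀ t s φ, IsLb φ → T t (T s φ) = T (t + s) φ

/-- `(x₀, …, x_k) ↦ T_t[φ(x₀, …, x_k, ·)](x_k)`, one step of the recursion that defines the
finite-dimensional distributions. -/
def step {X : Type*} (T : ℝ≥0 → (X → ℝ) → X → ℝ) (k : ℕ) (t : ℝ≥0)
    (φ : (Fin (k + 2) → X) → ℝ) (x : Fin (k + 1) → X) : ℝ :=
  T t (fun y => φ (Fin.snoc (α := fun _ => X) x y)) (x (Fin.last k))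

/-- The recursion stays inside bounded measurable functions (boundedness is automatic). -/
def HasMeasurableSteps {X : Type*} [MeasurableSpace X] (T : ℝ≥0 → (X → ℝ) → X → ℝ) : Prop :=
  ∀ (k : ℕ) (t : ℝ≥0) (φ : (Fin (k + 2) → X) → ℝ), IsLb φ → Measurable (step T k t φ)

/-- An invariant (sublinear) expectation of the semigroup `T`. -/
structure IsInvariantExpectation {X : Type*} [MeasurableSpace X]
    (T : ℝ≥0 → (X → ℝ) → X → ℝ) (T' : (X → ℝ) → ℝ) : Prop where
  sublinear : IsSublinearExpectation T'
  invariant : ∀ s φ, IsLb φ → T' (T s φ) = T' φ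

/-- The finite-dimensional distribution at times `t₀ < ⋯ < t_m`: the expectation of
`φ(ω(t₀), …, ω(t_m))`, obtained by applying the semigroup from the last variable backwards and
then `T'` to the function of `x₀` that is left. -/
def finDimExp {X : Type*} (T : ℝ≥0 → (X → ℝ) → X → ℝ) (T' : (X → ℝ) → ℝ) :
    (m : ℕ) → (Fin (m + 1) → ℝ) → ((Fin (m + 1) → X) → ℝ) → ℝ
  | 0, _, φ => T' (fun x => φ (fun _ => x))
  | m + 1, t, φ =>
      finDimExp T T' m (fun i => t i.castSucc)
        (step T m (t (Fin.last (m + 1)) - t (Fin.last m).castSucc).toNNReal φ)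

/-- The probability measures on path space `ℝ → X` (with the cylinder `σ`-algebra) dominated, on
bounded measurable cylinder functions, by the finite-dimensional distributions. Every cylinder
function can be written with strictly increasing times. -/
def canonicalPriors {X : Type*} [MeasurableSpace X] (T : ℝ≥0 → (X → ℝ) → X → ℝ)
    (T' : (X → ℝ) → ℝ) : Set (ProbabilityMeasure (ℝ → X)) :=
  {P | ∀ (m : ℕ) (t : Fin (m + 1) → ℝ), StrictMono t →
    ∀ φ : (Fin (m + 1) → X) → ℝ, IsLb φ →
      ∫ ω, φ (fun i => ω (t i)) ∂(P : Measure (ℝ → X)) ≤ finDimExp T T' m t φ}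

/-- The canonical expectation on path space, `sup_P E_P[ξ]` over the canonical priors, used for
bounded measurable `ξ`; on indicators it is the upper capacity. -/
def canonicalExp {X : Type*} [MeasurableSpace X] (T : ℝ≥0 → (X → ℝ) → X → ℝ)
    (T' : (X → ℝ) → ℝ) (ξ : (ℝ → X) → ℝ) : ℝ :=
  sSup ((fun P : ProbabilityMeasure (ℝ → X) => ∫ ω, ξ ω ∂(P : Measure (ℝ → X))) ''
    canonicalPriors T T')

/-- The shift `(θ_t ω)(s) = ω(t + s)` of path space. -/
def shift {X : Type*} (t : ℝ) (ω : ℝ → X) : ℝ → X := fun s => ω (t + s)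

/-- `A` is measurable and, for each real `t`, `I_A ∘ θ_t = I_A` quasi-surely. -/
def IsInvariantSet {X : Type*} [MeasurableSpace X] (T : ℝ≥0 → (X → ℝ) → X → ℝ)
    (T' : (X → ℝ) → ℝ) (A : Set (ℝ → X)) : Prop :=
  MeasurableSet A ∧ ∀ t : ℝ, HoldsAS (canonicalExp T T')
    (fun ω => A.indicator (fun _ => (1 : ℝ)) (shift t ω) = A.indicator (fun _ => (1 : ℝ)) ω)

/-- Ergodicity of `T'`: every invariant set of the canonical dynamical system has upper
expectation zero or its complement has. -/
def IsErgodic {X : Type*} [MeasurableSpace X] (T : ℝ≥0 → (X → ℝ) → X → ℝ)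
    (T' : (X → ℝ) → ℝ) : Prop :=
  ∀ A : Set (ℝ → X), IsInvariantSet T T' A →
    canonicalExp T T' (A.indicator (fun _ => 1)) = 0 ∨
      canonicalExp T T' (Aᶜ.indicator (fun _ => 1)) = 0

end SublinearErgodic

end

/-!
Absence of mean-uncertainty, applied to indicators, forces all probability measures representing
`T'` to agree, so `T'` is the integral against one probability measure `μ`
(`exists_eq_integral_of_mean`). Invariance then gives `∫ (T_t φ + T_t (-φ)) dμ = 0`, and the
integrand is nonnegative, so `T_t (-φ) = -T_t φ` holds `μ`-almost everywhere (`ae_eq_neg`). As the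
state space is countably generated, the exceptional null set can be chosen independently of `φ`:
outside it, all measures representing `T_t` at `x` agree. Hence `T_t` is given `μ`-almost
everywhere by a Markov kernel `κ t` (`exists_kernel`); these kernels preserve `μ` and satisfy the
Chapman–Kolmogorov equations almost everywhere (`isStationaryFamily_of_semigroup`).

Kolmogorov's extension theorem (`exists_isProjectiveLimit`) yields the law `P` on path space of the
stationary Markov process with these transitions (`exists_isChainLaw`). Its finite-dimensional
distributions are those of the semigroup, and `P` is the only canonical prior, so the canonical
expectation is the integral against `P` (`IsChainLaw.canonicalExp_eq`). What remains is the
classical criterion for stationary Markov processes.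

* If `T_t φ = φ` almost surely for all `t`, then `E|φ(X_t) - φ(X_0)|² = 0`, so each event
  `{φ(X_0) ∈ U}` is invariant (`IsChainLaw.ae_eq_of_harmonic_all`). Under ergodicity these events
  are trivial and `φ` is constant almost surely.
* Conversely, an invariant event `A` is approximated by cylinders, which may be shifted into the
  future or into the past; so `A` belongs to both completed `σ`-algebras
  (`IsChainLaw.indicator_ae_eq_condExp`). These are conditionally independent given the present
  (`IsChainLaw.condExp_future_eq`), so `A = {X_0 ∈ B}` up to a null set
  (`IsChainLaw.exists_eq_present`). The indicator of `B` is then fixed by the semigroup, hence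
  constant almost surely, and `A` is trivial.
-/

namespace SublinearErgodic

open Filter ProbabilityTheory
open scoped ENNReal Topology symmDiff

/-! ### Kolmogorov extension -/

section Kolmogorov

/-- Cylinders over compact sets form a compact system, in the sequential form: if each finite
stage `⋂ k ≤ n` is nonempty, then so is the whole intersection. Coordinates of a common point are
limits, along a nonprincipal ultrafilter, of coordinates of points of the finite stages. -/
lemma nonempty_iInter_compact_cylinder {ι : Type*} {α : ι → Type*} [∀ i, TopologicalSpace (α i)]
    [∀ i, T2Space (α i)] {I : ℕ → Finset ι}
    {K : ∀ n, Set (∀ i : I n, α i)} (hK : ∀ n, IsCompact (K n))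
    (hne : ∀ n, (⋂ k ≤ n, cylinder (I k) (K k)).Nonempty) :
    (⋂ n, cylinder (I n) (K n)).Nonempty := by
  classical
  choose ω hω using hne
  have hmem : ∀ k, ∀ᶠ n in (hyperfilter ℕ : Filter ℕ), (I k).restrict (ω n) ∈ K k := by
    intro k
    have h : ∀ᶠ n in (hyperfilter ℕ : Filter ℕ), k ≤ n :=
      Nat.hyperfilter_le_atTop (eventually_ge_atTop k)
    filter_upwards [h] with n hn
    exact Set.mem_iInter₂.1 (hω n) k hn
  have hlim : ∀ k, ∃ z ∈ K k,
      Tendsto (fun n => (I k).restrict (ω n)) (hyperfilter ℕ : Filter ℕ) (𝓝 z) := by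
    intro k
    obtain ⟨z, hz, hz'⟩ := (hK k).ultrafilter_le_nhds
      ((hyperfilter ℕ).map fun n => (I k).restrict (ω n)) (by
        rw [le_principal_iff]; exact hmem k)
    exact ⟨z, hz, hz'⟩
  choose z hzK hz using hlim
  -- Coordinates outside all `I k` need not converge; they do not matter.
  let ω' : ∀ i, α i := fun i =>
    if h : ∃ y, Tendsto (fun n => ω n i) (hyperfilter ℕ : Filter ℕ) (𝓝 y) then h.choose else ω 0 i
  refine ⟨ω', Set.mem_iInter.2 fun k => ?_⟩
  have : (I k).restrict ω' = z k := by
    ext i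
    have hi : Tendsto (fun n => ω n i) (hyperfilter ℕ : Filter ℕ) (𝓝 (z k i)) :=
      (tendsto_pi_nhds.1 (hz k)) i
    have hex : ∃ y, Tendsto (fun n => ω n i) (hyperfilter ℕ : Filter ℕ) (𝓝 y) := ⟨_, hi⟩
    have h1 : ω' i = hex.choose := dif_pos hex
    exact h1.trans (tendsto_nhds_unique hex.choose_spec hi)
  rw [mem_cylinder, this]
  exact hzK k

variable {ι : Type*} {α : ι → Type*} [∀ i, TopologicalSpace (α i)] [∀ i, PolishSpace (α i)]
  [∀ i, MeasurableSpace (α i)] [∀ i, BorelSpace (α i)]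

/-- Continuity at `∅` of the content of a projective family, by inner regularity. -/
lemma tendsto_projectiveFamilyContent_zero
    {P : ∀ J : Finset ι, Measure (∀ j : J, α j)} [∀ J, IsFiniteMeasure (P J)]
    (hP : IsProjectiveMeasureFamily P) {A : ℕ → Set (∀ i, α i)}
    (hA : ∀ n, A n ∈ measurableCylinders α) (hanti : Antitone A) (hinter : ⋂ n, A n = ∅) :
    Tendsto (fun n => projectiveFamilyContent hP (A n)) atTop (𝓝 0) := by
  have hmono : Antitone fun n => projectiveFamilyContent hP (A n) := fun m n h =>
    projectiveFamilyContent_mono hP (hA n) (hA m) (hanti h)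
  have hlim := tendsto_atTop_iInf hmono
  by_contra hne
  have hε : (⨅ n, projectiveFamilyContent hP (A n)) ≠ 0 := fun h => hne (h ▸ hlim)
  obtain ⟨δ, hδ, hsum⟩ := ENNReal.exists_pos_sum_of_countable' hε ℕ
  choose I S hS hAS using fun n => (mem_measurableCylinders (A n)).1 (hA n)
  have hK : ∀ n, ∃ K ⊆ S n, IsCompact K ∧ P (I n) (S n \ K) < δ n := fun n =>
    (hS n).exists_isCompact_sdiff_lt (measure_ne_top _ _) (hδ n).ne'
  choose K hKS hKc hKδ using hK
  have hKm : ∀ n, MeasurableSet (K n) := fun n => (hKc n).measurableSet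
  have hdiff : ∀ n, A n \ cylinder (I n) (K n) = cylinder (I n) (S n \ K n) := fun n => by
    rw [hAS n, sdiff_cylinder_same]
  have hcyl : ∀ n, A n \ cylinder (I n) (K n) ∈ measurableCylinders α := fun n => by
    rw [hdiff]; exact cylinder_mem_measurableCylinders _ _ ((hS n).diff (hKm n))
  have hne' : ∀ n, (⋂ k ≤ n, cylinder (I k) (K k)).Nonempty := by
    intro n
    by_contra hempty
    rw [Set.not_nonempty_iff_eq_empty] at hempty
    have hsub : A n ⊆ ⋃ k ≤ n, A k \ cylinder (I k) (K k) := by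
      intro ω hω
      have : ω ∉ ⋂ k ≤ n, cylinder (I k) (K k) := by rw [hempty]; exact id
      simp only [Set.mem_iInter, not_forall] at this
      obtain ⟨k, hk, hωk⟩ := this
      exact Set.mem_iUnion₂.2 ⟨k, hk, hanti hk hω, hωk⟩
    have hU : (⋃ k ≤ n, A k \ cylinder (I k) (K k)) ∈ measurableCylinders α := by
      have := isSetRing_measurableCylinders (α := α).biUnion_mem (Finset.range (n + 1))
        fun k _ => hcyl k
      simpa only [Finset.mem_range_succ_iff] using this
    have h1 : projectiveFamilyContent hP (A n) ≤ ∑' k, δ k :=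
      calc projectiveFamilyContent hP (A n)
          ≤ projectiveFamilyContent hP (⋃ k ≤ n, A k \ cylinder (I k) (K k)) :=
            projectiveFamilyContent_mono hP (hA n) hU hsub
        _ ≤ ∑ k ∈ Finset.range (n + 1), projectiveFamilyContent hP (A k \ cylinder (I k) (K k)) :=
            projectiveFamilyContent_iUnion_le hP hcyl n
        _ ≤ ∑ k ∈ Finset.range (n + 1), δ k := by
            refine Finset.sum_le_sum fun k _ => ?_
            rw [hdiff, projectiveFamilyContent_cylinder hP ((hS k).diff (hKm k))]
            exact (hKδ k).le
        _ ≤ ∑' k, δ k := ENNReal.sum_le_tsum _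
    exact absurd ((iInf_le _ n).trans h1) (not_le.2 hsum)
  obtain ⟨ω, hω⟩ := nonempty_iInter_compact_cylinder hKc hne'
  have : ω ∈ ⋂ n, A n := by
    refine Set.mem_iInter.2 fun n => ?_
    rw [hAS n]
    exact hKS n (Set.mem_iInter.1 hω n)
  rw [hinter] at this
  exact this

/-- **Kolmogorov extension theorem** for Polish spaces. -/
theorem exists_isProjectiveLimit {P : ∀ J : Finset ι, Measure (∀ j : J, α j)}
    [∀ J, IsFiniteMeasure (P J)] (hP : IsProjectiveMeasureFamily P) :
    ∃ Q : Measure (∀ i, α i), IsProjectiveLimit Q P := by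
  have hsub : (projectiveFamilyContent hP).IsSigmaSubadditive := by
    refine isSigmaSubadditive_of_addContent_iUnion_eq_tsum isSetRing_measurableCylinders
      fun f hf hfU hf' => ?_
    exact addContent_iUnion_eq_sum_of_tendsto_zero isSetRing_measurableCylinders _
      (fun _ _ => projectiveFamilyContent_ne_top hP)
      (fun s hs hanti hinter => tendsto_projectiveFamilyContent_zero hP hs hanti hinter) hf hfU hf'
  refine ⟨(projectiveFamilyContent hP).measure isSetSemiring_measurableCylinders
    generateFrom_measurableCylinders.ge hsub, fun I => ?_⟩
  ext s hs
  rw [Measure.map_apply (by fun_prop) hs, AddContent.measure_eq]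
  · exact projectiveFamilyContent_congr hP _ rfl hs
  · exact generateFrom_measurableCylinders.symm
  · exact cylinder_mem_measurableCylinders _ _ hs

end Kolmogorov

/-! ### Iterated integrals along a chain of kernels -/

section Chain

variable {X : Type*} [MeasurableSpace X]

/-- A probability measure `μ` that is invariant under the Markov kernels `κ t`, `t ≥ 0`, which
satisfy the Chapman–Kolmogorov equations `μ`-almost everywhere. -/
structure IsStationaryFamily (κ : ℝ≥0 → Kernel X X) (μ : Measure X) : Prop where
  prob : IsProbabilityMeasure μ
  markov : ∀ t, IsMarkovKernel (κ t)
  invariant : ∀ t, (κ t).Invariant μ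
  comp : ∀ s t, ∀ᵐ x ∂μ, (κ t ∘ₖ κ s) x = κ (s + t) x

/-- `E[f₁(X_{t₁}) ⋯ f_m(X_{t_m}) | X_s = x]` for the list `[(t₁, f₁), …, (t_m, f_m)]` of increasing
times after `s`, as an iterated integral. -/
noncomputable def chainFrom (κ : ℝ≥0 → Kernel X X) : List (ℝ × (X → ℝ≥0∞)) → ℝ → X → ℝ≥0∞
  | [], _, _ => 1
  | p :: L, s, x => ∫⁻ y, p.2 y * chainFrom κ L p.1 y ∂(κ (p.1 - s).toNNReal x)

/-- `E[f₁(X_{t₁}) ⋯ f_m(X_{t_m})]` for the list `[(t₁, f₁), …, (t_m, f_m)]` of increasing times and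
the chain with marginals `μ`. -/
noncomputable def chain (κ : ℝ≥0 → Kernel X X) (μ : Measure X) :
    List (ℝ × (X → ℝ≥0∞)) → ℝ≥0∞
  | [] => 1
  | p :: L => ∫⁻ y, p.2 y * chainFrom κ L p.1 y ∂μ

/-- The product `f₁(ω(t₁)) ⋯ f_m(ω(t_m))` along a path. -/
noncomputable def pathProd (L : List (ℝ × (X → ℝ≥0∞))) (ω : ℝ → X) : ℝ≥0∞ :=
  (L.map fun p => p.2 (ω p.1)).prod

lemma measurable_pathProd {L : List (ℝ × (X → ℝ≥0∞))} (hL : ∀ p ∈ L, Measurable p.2) :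
    Measurable (pathProd L) := by
  induction L with
  | nil => exact measurable_const
  | cons p L ih =>
    have h1 : Measurable fun ω : ℝ → X => p.2 (ω p.1) :=
      (hL p (by simp)).comp (measurable_pi_apply _)
    have : pathProd (p :: L) = fun ω : ℝ → X => p.2 (ω p.1) * pathProd L ω := by
      ext ω; simp [pathProd]
    rw [this]
    exact h1.mul (ih fun q hq => hL q (by simp [hq]))

variable {κ : ℝ≥0 → Kernel X X} {μ : Measure X}

lemma measurable_chainFrom {L : List (ℝ × (X → ℝ≥0∞))} (hL : ∀ p ∈ L, Measurable p.2) (s : ℝ) :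
    Measurable (chainFrom κ L s) := by
  induction L generalizing s with
  | nil => exact measurable_const
  | cons p L ih =>
    have hp : Measurable p.2 := hL p (by simp)
    have := ih (fun q hq => hL q (by simp [hq])) p.1
    exact (hp.mul this).lintegral_kernel

lemma chainFrom_shift (L : List (ℝ × (X → ℝ≥0∞))) (s a : ℝ) :
    chainFrom κ (L.map fun p => (a + p.1, p.2)) (a + s) = chainFrom κ L s := by
  induction L generalizing s with
  | nil => rfl
  | cons p L ih =>
    ext x
    simp only [List.map_cons, chainFrom, ih, add_sub_add_left_eq_sub]

lemma chain_shift (L : List (ℝ × (X → ℝ≥0∞))) (a : ℝ) :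
    chain κ μ (L.map fun p => (a + p.1, p.2)) = chain κ μ L := by
  cases L with
  | nil => rfl
  | cons p L => simp only [List.map_cons, chain, chainFrom_shift]

/-- The factors after time `r` may be integrated out into the factor at time `r`. -/
lemma chainFrom_append (L₁ L₂ : List (ℝ × (X → ℝ≥0∞))) (r : ℝ) (g : X → ℝ≥0∞) (s : ℝ) :
    chainFrom κ (L₁ ++ (r, g) :: L₂) s =
      chainFrom κ (L₁ ++ [(r, fun y => g y * chainFrom κ L₂ r y)]) s := by
  induction L₁ generalizing s with
  | nil => ext x; simp [chainFrom]
  | cons p L₁ ih => ext x; simp only [List.cons_append, chainFrom, ih]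

lemma chain_append (L₁ L₂ : List (ℝ × (X → ℝ≥0∞))) (r : ℝ) (g : X → ℝ≥0∞) :
    chain κ μ (L₁ ++ (r, g) :: L₂) =
      chain κ μ (L₁ ++ [(r, fun y => g y * chainFrom κ L₂ r y)]) := by
  cases L₁ with
  | nil => simp [chain, chainFrom]
  | cons p L₁ => 
    simp only [List.cons_append, chain]
    rw [chainFrom_append]

lemma IsStationaryFamily.ae_ae (h : IsStationaryFamily κ μ) {p : X → Prop}
    (hp : ∀ᵐ x ∂μ, p x) (t : ℝ≥0) : ∀ᵐ x ∂μ, ∀ᵐ y ∂(κ t x), p y := by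
  have := h.markov t
  rw [← (h.invariant t).def] at hp
  exact Measure.ae_ae_of_ae_comp hp

lemma IsStationaryFamily.lintegral_lintegral (h : IsStationaryFamily κ μ) {f : X → ℝ≥0∞}
    (hf : Measurable f) (t : ℝ≥0) : ∫⁻ x, ∫⁻ y, f y ∂(κ t x) ∂μ = ∫⁻ x, f x ∂μ := by
  conv_rhs => rw [← (h.invariant t).def]
  rw [Measure.lintegral_bind (κ t).aemeasurable hf.aemeasurable]

/-- A trivial factor at the first time may be dropped, by the Chapman–Kolmogorov equation. -/
lemma IsStationaryFamily.chainFrom_cons_one (h : IsStationaryFamily κ μ)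
    {L : List (ℝ × (X → ℝ≥0∞))} (hL : ∀ p ∈ L, Measurable p.2) {s t : ℝ} (hst : s ≤ t)
    (ht : ∀ p ∈ L, t ≤ p.1) : chainFrom κ ((t, 1) :: L) s =ᵐ[μ] chainFrom κ L s := by
  have := h.markov
  cases L with
  | nil => exact .of_forall fun x => by simp [chainFrom]
  | cons q L =>
    have hq : Measurable fun z => q.2 z * chainFrom κ L q.1 z :=
      (hL q (by simp)).mul (measurable_chainFrom (fun p hp => hL p (by simp [hp])) _)
    have htq : t ≤ q.1 := ht q (by simp)
    filter_upwards [h.comp (t - s).toNNReal (q.1 - t).toNNReal] with x hx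
    rw [← Real.toNNReal_add (by linarith) (by linarith), add_comm, sub_add_sub_cancel] at hx
    simp only [chainFrom, Pi.one_apply, one_mul]
    rw [← hx, Kernel.lintegral_comp _ _ _ hq]

lemma IsStationaryFamily.chain_cons_one (h : IsStationaryFamily κ μ)
    {L : List (ℝ × (X → ℝ≥0∞))} (hL : ∀ p ∈ L, Measurable p.2) (t : ℝ) :
    chain κ μ ((t, 1) :: L) = chain κ μ L := by
  have := h.prob
  cases L with
  | nil => simp [chain, chainFrom]
  | cons q L =>
    have hq : Measurable fun z => q.2 z * chainFrom κ L q.1 z :=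
      (hL q (by simp)).mul (measurable_chainFrom (fun p hp => hL p (by simp [hp])) _)
    simp only [chain, chainFrom, Pi.one_apply, one_mul]
    exact h.lintegral_lintegral hq _

lemma IsStationaryFamily.chainFrom_filter (h : IsStationaryFamily κ μ) (K : ℝ → Prop)
    [DecidablePred K] {L : List (ℝ × (X → ℝ≥0∞))} (hL : ∀ p ∈ L, Measurable p.2)
    (hs : L.Pairwise fun p q => p.1 ≤ q.1) (hK : ∀ p ∈ L, ¬ K p.1 → p.2 = 1) {s : ℝ}
    (hsL : ∀ p ∈ L, s ≤ p.1) :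
    chainFrom κ L s =ᵐ[μ] chainFrom κ (L.filter fun p => K p.1) s := by
  induction L generalizing s with
  | nil => exact .of_forall fun x => rfl
  | cons p L ih =>
    rw [List.pairwise_cons] at hs
    have hL' : ∀ p ∈ L, Measurable p.2 := fun q hq => hL q (by simp [hq])
    have ih' := fun {s} => @ih hL' hs.2 (fun q hq => hK q (by simp [hq])) s
    by_cases hp : K p.1
    · rw [List.filter_cons_of_pos (by simpa using hp)]
      filter_upwards [h.ae_ae (ih' hs.1) (p.1 - s).toNNReal] with x hx
      exact lintegral_congr_ae (by filter_upwards [hx] with y hy; rw [hy])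
    · rw [List.filter_cons_of_neg (by simpa using hp)]
      have h1 : p = (p.1, 1) := Prod.ext rfl (hK p (by simp) hp)
      rw [h1]
      exact (h.chainFrom_cons_one hL' (hsL p (by simp)) hs.1).trans
        (ih' fun q hq => hsL q (by simp [hq]))

/-- Times with a trivial factor may be dropped: the consistency of the chain. -/
lemma IsStationaryFamily.chain_filter (h : IsStationaryFamily κ μ) (K : ℝ → Prop)
    [DecidablePred K] {L : List (ℝ × (X → ℝ≥0∞))} (hL : ∀ p ∈ L, Measurable p.2)
    (hs : L.Pairwise fun p q => p.1 ≤ q.1) (hK : ∀ p ∈ L, ¬ K p.1 → p.2 = 1) :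
    chain κ μ L = chain κ μ (L.filter fun p => K p.1) := by
  induction L with
  | nil => rfl
  | cons p L ih =>
    rw [List.pairwise_cons] at hs
    have hL' : ∀ p ∈ L, Measurable p.2 := fun q hq => hL q (by simp [hq])
    have hK' : ∀ p ∈ L, ¬ K p.1 → p.2 = 1 := fun q hq => hK q (by simp [hq])
    by_cases hp : K p.1
    · rw [List.filter_cons_of_pos (by simpa using hp)]
      refine lintegral_congr_ae ?_
      filter_upwards [h.chainFrom_filter K hL' hs.2 hK' hs.1] with y hy
      rw [hy]
    · rw [List.filter_cons_of_neg (by simpa using hp), ← ih hL' hs.2 hK']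
      have h1 : p = (p.1, 1) := Prod.ext rfl (hK p (by simp) hp)
      rw [h1]
      exact h.chain_cons_one hL' _

end Chain

section PathLaw

variable {X : Type*} [MeasurableSpace X]

lemma measurable_update_snd (t : ℝ) :
    Measurable fun p : X × (ℝ → X) => Function.update p.2 t p.1 := by
  refine measurable_pi_lambda _ fun s => ?_
  by_cases hs : s = t
  · subst hs; simpa using measurable_fst
  · simp only [Function.update_of_ne hs]
    exact (measurable_pi_apply s).comp measurable_snd

/-- A law on paths, given the value `x` at time `s`, whose coordinates at the times in the
(increasing) list are those of the chain. The other coordinates are irrelevant. -/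
noncomputable def pathKernel (κ : ℝ≥0 → Kernel X X) : List ℝ → ℝ → Kernel X (ℝ → X)
  | [], _ => Kernel.deterministic (fun x _ => x) (measurable_pi_lambda _ fun _ => measurable_id)
  | t :: l, s => ((κ (t - s).toNNReal) ⊗ₖ (Kernel.prodMkLeft X (pathKernel κ l t))).map
      fun p => Function.update p.2 t p.1

/-- A law on paths whose coordinates at the times in the (increasing) list are those of the
chain with marginals `μ`. -/
noncomputable def pathLaw (κ : ℝ≥0 → Kernel X X) (μ : Measure X) : List ℝ → Measure (ℝ → X)
  | [] => μ.map fun x _ => x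
  | t :: l => (μ ⊗ₘ pathKernel κ l t).map fun p => Function.update p.2 t p.1

lemma pathProd_update {X : Type*} {L : List (ℝ × (X → ℝ≥0∞))} {p : ℝ × (X → ℝ≥0∞)}
    (hp : p.1 ∉ L.map Prod.fst) (y : X) (ω : ℝ → X) :
    pathProd (p :: L) (Function.update ω p.1 y) = p.2 y * pathProd L ω := by
  simp only [pathProd, List.map_cons, List.prod_cons, Function.update_self]
  congr 2
  refine List.map_congr_left fun q hq => ?_
  rw [Function.update_of_ne]
  rintro h
  exact hp (h ▸ List.mem_map_of_mem hq)

variable {κ : ℝ≥0 → Kernel X X} {μ : Measure X}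

lemma isMarkovKernel_pathKernel (hκ : ∀ t, IsMarkovKernel (κ t)) (l : List ℝ) (s : ℝ) :
    IsMarkovKernel (pathKernel κ l s) := by
  induction l generalizing s with
  | nil => rw [pathKernel]; infer_instance
  | cons t l ih =>
    have := ih t
    rw [pathKernel]
    exact Kernel.IsMarkovKernel.map _ (measurable_update_snd t)

lemma isProbabilityMeasure_pathLaw (h : IsStationaryFamily κ μ) (l : List ℝ) :
    IsProbabilityMeasure (pathLaw κ μ l) := by
  have := h.prob
  cases l with
  | nil =>
    exact Measure.isProbabilityMeasure_map
      (measurable_pi_lambda _ fun _ => measurable_id).aemeasurable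
  | cons t l =>
    have := isMarkovKernel_pathKernel h.markov l t
    exact Measure.isProbabilityMeasure_map (measurable_update_snd t).aemeasurable

lemma lintegral_pathKernel (hκ : ∀ t, IsMarkovKernel (κ t)) {L : List (ℝ × (X → ℝ≥0∞))}
    (hL : ∀ p ∈ L, Measurable p.2) (hnd : (L.map Prod.fst).Nodup) (s : ℝ) (x : X) :
    ∫⁻ ω, pathProd L ω ∂(pathKernel κ (L.map Prod.fst) s x) = chainFrom κ L s x := by
  induction L generalizing s x with
  | nil =>
    have := isMarkovKernel_pathKernel hκ [] s
    simp [pathProd, chainFrom]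
  | cons p L ih =>
    rw [List.map_cons, List.nodup_cons] at hnd
    have hL' : ∀ p ∈ L, Measurable p.2 := fun q hq => hL q (by simp [hq])
    have hp := hL p (by simp)
    have := isMarkovKernel_pathKernel hκ (L.map Prod.fst) p.1
    have hm := measurable_pathProd hL'
    rw [List.map_cons, pathKernel, Kernel.lintegral_map _ (measurable_update_snd _) _
      (measurable_pathProd hL)]
    simp only [pathProd_update hnd.1]
    rw [Kernel.lintegral_compProd _ _ _ (by fun_prop), chainFrom]
    refine lintegral_congr fun y => ?_
    dsimp only
    rw [lintegral_const_mul _ hm, Kernel.prodMkLeft_apply, ih hL' hnd.2]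

lemma lintegral_pathLaw (h : IsStationaryFamily κ μ) {L : List (ℝ × (X → ℝ≥0∞))}
    (hL : ∀ p ∈ L, Measurable p.2) (hnd : (L.map Prod.fst).Nodup) :
    ∫⁻ ω, pathProd L ω ∂(pathLaw κ μ (L.map Prod.fst)) = chain κ μ L := by
  have := h.prob
  cases L with
  | nil =>
    have := isProbabilityMeasure_pathLaw h []
    simp [pathProd, chain]
  | cons p L =>
    rw [List.map_cons, List.nodup_cons] at hnd
    have hL' : ∀ p ∈ L, Measurable p.2 := fun q hq => hL q (by simp [hq])
    have hp := hL p (by simp)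
    have := isMarkovKernel_pathKernel h.markov (L.map Prod.fst) p.1
    have hm := measurable_pathProd hL'
    rw [List.map_cons, pathLaw, lintegral_map (measurable_pathProd hL) (measurable_update_snd _)]
    simp only [pathProd_update hnd.1]
    rw [Measure.lintegral_compProd (by fun_prop), chain]
    refine lintegral_congr fun y => ?_
    dsimp only
    rw [lintegral_const_mul _ hm, lintegral_pathKernel h.markov hL' hnd.2]

end PathLaw

/-! ### Existence of the stationary Markov law -/

section ChainLaw

variable {X : Type*} [MeasurableSpace X]

/-- The list of times `l` with the indicator of `B t` attached to each time `t`. -/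
noncomputable def boxList {X : Type*} (B : ℝ → Set X) (l : List ℝ) : List (ℝ × (X → ℝ≥0∞)) :=
  l.map fun t => (t, (B t).indicator 1)

lemma pathProd_boxList {X : Type*} (B : ℝ → Set X) (l : List ℝ) :
    pathProd (boxList B l) = {ω | ∀ t ∈ l, ω t ∈ B t}.indicator 1 := by
  classical
  ext ω
  induction l with
  | nil => simp [pathProd, boxList]
  | cons t l ih =>
    have : pathProd (boxList B (t :: l)) ω = (B t).indicator 1 (ω t) * pathProd (boxList B l) ω := by
      simp [pathProd, boxList]
    rw [this, ih]
    by_cases h1 : ω t ∈ B t <;> by_cases h2 : ∀ t ∈ l, ω t ∈ B t <;>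
      simp [Set.indicator, h1, h2]

lemma pathProd_append {X : Type*} (L₁ L₂ : List (ℝ × (X → ℝ≥0∞))) (ω : ℝ → X) :
    pathProd (L₁ ++ L₂) ω = pathProd L₁ ω * pathProd L₂ ω := by
  simp [pathProd]

lemma measurable_of_mem_boxList {B : ℝ → Set X} (hB : ∀ t, MeasurableSet (B t)) {l : List ℝ} :
    ∀ p ∈ boxList B l, Measurable p.2 := by
  intro p hp
  obtain ⟨t, -, rfl⟩ := List.mem_map.1 hp
  exact measurable_one.indicator (hB t)

lemma measurableSet_box {B : ℝ → Set X} (hB : ∀ t, MeasurableSet (B t)) (l : List ℝ) :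
    MeasurableSet {ω : ℝ → X | ∀ t ∈ l, ω t ∈ B t} := by
  have : {ω : ℝ → X | ∀ t ∈ l, ω t ∈ B t} = ⋂ t ∈ l.toFinset, (fun ω => ω t) ⁻¹' B t := by
    ext ω; simp
  rw [this]
  exact Finset.measurableSet_biInter _ fun t _ => measurable_pi_apply t (hB t)

/-- `P` is the law of a stationary Markov process with transition kernels `κ` and marginals `μ`. -/
def IsChainLaw (κ : ℝ≥0 → Kernel X X) (μ : Measure X) (P : Measure (ℝ → X)) : Prop :=
  ∀ L : List (ℝ × (X → ℝ≥0∞)), (∀ p ∈ L, Measurable p.2) → (L.Pairwise fun p q => p.1 < q.1) →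
    ∫⁻ ω, pathProd L ω ∂P = chain κ μ L

variable {κ : ℝ≥0 → Kernel X X} {μ : Measure X}

/-- The laws of the chain at finite sets of times. -/
noncomputable def finiteLaw (κ : ℝ≥0 → Kernel X X) (μ : Measure X) (J : Finset ℝ) :
    Measure (J → X) :=
  (pathLaw κ μ J.sort).map J.restrict

lemma map_fst_boxList {X : Type*} (B : ℝ → Set X) (l : List ℝ) :
    (boxList B l).map Prod.fst = l := by
  simp [boxList, Function.comp_def]

lemma boxList_pairwise {X : Type*} (B : ℝ → Set X) (J : Finset ℝ) :
    (boxList B J.sort).Pairwise fun p q => p.1 < q.1 := by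
  rw [boxList, List.pairwise_map]
  exact J.sortedLT_sort.pairwise

lemma isProjectiveMeasureFamily_finiteLaw (h : IsStationaryFamily κ μ) :
    IsProjectiveMeasureFamily (α := fun _ : ℝ => X) (finiteLaw κ μ) := by
  classical
  intro I J hJI
  have := isProbabilityMeasure_pathLaw h I.sort
  have := isProbabilityMeasure_pathLaw h J.sort
  have hr : Finset.restrict₂ (π := fun _ : ℝ => X) hJI ∘ I.restrict (π := fun _ => X) =
      J.restrict (π := fun _ => X) := rfl
  rw [finiteLaw, finiteLaw, Measure.map_map (Finset.measurable_restrict₂ hJI)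
    (Finset.measurable_restrict I), hr]
  have hfin : IsFiniteMeasure ((pathLaw κ μ J.sort).map J.restrict) := inferInstance
  refine ext_of_generate_finite _ generateFrom_pi.symm isPiSystem_pi ?_ ?_
  · rintro s ⟨B, hB, rfl⟩
    have hB : ∀ j : J, MeasurableSet (B j) := fun j => hB j (Set.mem_univ j)
    have hm : MeasurableSet (Set.univ.pi B) := MeasurableSet.univ_pi hB
    rw [Measure.map_apply (by fun_prop) hm, Measure.map_apply (by fun_prop) hm]
    -- A box over `J` is a box over any larger set of times, unconstrained at the additional times;
    -- there the factor is `1` and can be dropped.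
    let B' : ℝ → Set X := fun t => if ht : t ∈ J then B ⟨t, ht⟩ else Set.univ
    have hB' : ∀ t, MeasurableSet (B' t) := fun t => by
      by_cases ht : t ∈ J <;> simp [B', ht, hB]
    have hpre : ∀ K : Finset ℝ, J ⊆ K →
        J.restrict ⁻¹' Set.univ.pi B = {ω : ℝ → X | ∀ t ∈ K.sort, ω t ∈ B' t} := by
      intro K hK
      ext ω
      simp only [Set.mem_preimage, Set.mem_univ_pi, Finset.restrict, Set.mem_ofPred_eq,
        Finset.mem_sort, B']
      constructor
      · intro hω t _
        by_cases ht : t ∈ J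
        · simpa [ht] using hω ⟨t, ht⟩
        · simp [ht]
      · intro hω j
        simpa using hω j (hK j.2)
    have hval : ∀ K : Finset ℝ, J ⊆ K →
        pathLaw κ μ K.sort (J.restrict ⁻¹' Set.univ.pi B) = chain κ μ (boxList B' K.sort) := by
      intro K hK
      rw [hpre K hK, ← lintegral_indicator_one (measurableSet_box hB' _), ← pathProd_boxList]
      have := lintegral_pathLaw h (L := boxList B' K.sort) (measurable_of_mem_boxList hB')
        (by rw [map_fst_boxList]; exact K.sort_nodup _)
      rwa [map_fst_boxList] at this
    rw [hval I hJI, hval J subset_rfl, h.chain_filter (fun t => t ∈ J)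
      (measurable_of_mem_boxList hB') ((boxList_pairwise B' I).imp le_of_lt) ?_]
    · congr 1
      rw [boxList, boxList, List.filter_map]
      congr 1
      refine List.Perm.eq_of_pairwise (le := (· ≤ ·)) (fun _ _ _ _ => le_antisymm)
        (J.sortedLT_sort.pairwise.imp le_of_lt)
        ((I.sortedLT_sort.pairwise.imp le_of_lt).filter _) ?_
      rw [List.perm_ext_iff_of_nodup (J.sort_nodup _) ((I.sort_nodup _).filter _)]
      intro t
      simpa using fun ht => hJI ht
    · intro p hp hpJ
      obtain ⟨t, -, rfl⟩ := List.mem_map.1 hp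
      simp only at hpJ
      simp [B', hpJ]
  · rw [Measure.map_apply (by fun_prop) .univ, Measure.map_apply (by fun_prop) .univ]
    simp

theorem exists_isChainLaw [TopologicalSpace X] [PolishSpace X] [BorelSpace X]
    (h : IsStationaryFamily κ μ) : ∃ P : Measure (ℝ → X), IsChainLaw κ μ P := by
  have := h.prob
  have : ∀ J, IsFiniteMeasure (finiteLaw κ μ J) := fun J => by
    have := isProbabilityMeasure_pathLaw h J.sort
    rw [finiteLaw]; infer_instance
  obtain ⟨P, hP⟩ := exists_isProjectiveLimit (isProjectiveMeasureFamily_finiteLaw h)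
  refine ⟨P, fun L hL hs => ?_⟩
  obtain ⟨x₀⟩ : Nonempty X := nonempty_of_isProbabilityMeasure μ
  have hs' : (L.map Prod.fst).SortedLT := List.Pairwise.sortedLT (List.pairwise_map.2 hs)
  let I : Finset ℝ := (L.map Prod.fst).toFinset
  have hI : I.sort = L.map Prod.fst := by
    refine List.Perm.eq_of_pairwise (le := (· ≤ ·)) (fun _ _ _ _ => le_antisymm)
      (I.sortedLT_sort.pairwise.imp le_of_lt) (hs'.pairwise.imp le_of_lt) ?_
    rw [List.perm_ext_iff_of_nodup (I.sort_nodup _) hs'.nodup]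
    simp [I]
  -- A path is replaced by one that agrees with it on `I` and depends on the coordinates in `I` only.
  let e : (I → X) → ℝ → X := fun z t => if ht : t ∈ I then z ⟨t, ht⟩ else x₀
  have he : Measurable e := by
    refine measurable_pi_lambda _ fun t => ?_
    by_cases ht : t ∈ I <;> simp only [e, ht, dite_true, dite_false]
    · exact measurable_pi_apply _
    · exact measurable_const
  have hprod : ∀ ω : ℝ → X, pathProd L (e (I.restrict ω)) = pathProd L ω := by
    intro ω
    simp only [pathProd]
    congr 1
    refine List.map_congr_left fun p hp => ?_
    have : p.1 ∈ I := List.mem_toFinset.2 (List.mem_map_of_mem hp)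
    simp [e, this]
  have hm := (measurable_pathProd hL).comp he
  calc ∫⁻ ω, pathProd L ω ∂P = ∫⁻ ω, (pathProd L ∘ e) (I.restrict ω) ∂P := by
        simp only [Function.comp_apply, hprod]
    _ = ∫⁻ z, (pathProd L ∘ e) z ∂(finiteLaw κ μ I) := by
        rw [← hP I, lintegral_map hm (by fun_prop)]
    _ = ∫⁻ ω, pathProd L ω ∂(pathLaw κ μ (L.map Prod.fst)) := by
        rw [finiteLaw, hI, lintegral_map hm (by fun_prop)]
        simp only [Function.comp_apply, hprod]
    _ = chain κ μ L := lintegral_pathLaw h hL hs'.nodup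

end ChainLaw

/-! ### Stationarity and the Markov property -/

section Markov

variable {X : Type*} [MeasurableSpace X]

/-- The finite-dimensional boxes with times in `Δ`, a π-system generating `cylinderEvents Δ`. -/
def boxes (X : Type*) [MeasurableSpace X] (Δ : Set ℝ) : Set (Set (ℝ → X)) :=
  piiUnionInter (fun t => {s | MeasurableSet[MeasurableSpace.comap (fun ω : ℝ → X => ω t) ‹_›] s}) Δ

lemma isPiSystem_boxes (Δ : Set ℝ) : IsPiSystem (boxes X Δ) :=
  isPiSystem_piiUnionInter _ (fun _ => @MeasurableSpace.isPiSystem_measurableSet _ (_)) _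

lemma generateFrom_boxes (Δ : Set ℝ) :
    cylinderEvents (X := fun _ : ℝ => X) Δ = MeasurableSpace.generateFrom (boxes X Δ) :=
  (generateFrom_piiUnionInter_measurableSet _ Δ).symm

lemma exists_of_mem_boxes {Δ : Set ℝ} {s : Set (ℝ → X)} (hs : s ∈ boxes X Δ) :
    ∃ (J : Finset ℝ) (B : ℝ → Set X), ↑J ⊆ Δ ∧ (∀ t, MeasurableSet (B t)) ∧
      s = {ω | ∀ t ∈ J, ω t ∈ B t} := by
  classical
  obtain ⟨J, hJ, f, hf, rfl⟩ := hs
  choose! B hB hBf using hf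
  refine ⟨J, fun t => if t ∈ J then B t else Set.univ, hJ, fun t => ?_, ?_⟩
  · by_cases ht : t ∈ J <;> simp [ht, hB]
  · ext ω
    simp only [Set.mem_iInter, Set.mem_ofPred_eq]
    refine forall₂_congr fun t ht => ?_
    rw [← hBf t ht, if_pos ht]
    rfl

lemma measurable_shift (a : ℝ) : Measurable (shift a : (ℝ → X) → ℝ → X) :=
  measurable_pi_lambda _ fun _ => measurable_pi_apply _

variable {κ : ℝ≥0 → Kernel X X} {μ : Measure X} {P : Measure (ℝ → X)}

lemma IsChainLaw.isProbabilityMeasure (hP : IsChainLaw κ μ P) : IsProbabilityMeasure P := by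
  refine ⟨?_⟩
  simpa [pathProd, chain] using hP [] (by simp) (by simp)

lemma IsChainLaw.map_eval (hP : IsChainLaw κ μ P) (t : ℝ) : P.map (fun ω => ω t) = μ := by
  ext B hB
  rw [Measure.map_apply (measurable_pi_apply t) hB]
  have := hP [(t, B.indicator 1)] (by simpa using measurable_one.indicator hB) (by simp)
  simp only [chain, chainFrom, mul_one, lintegral_indicator_one hB] at this
  rw [← this, ← lintegral_indicator_one (measurable_pi_apply t hB)]
  simp only [pathProd, List.map_cons, List.map_nil, List.prod_cons, List.prod_nil, mul_one]
  rfl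

/-- The law of the chain is invariant under the shift of paths. -/
lemma IsChainLaw.map_shift (hP : IsChainLaw κ μ P) (a : ℝ) : P.map (shift a) = P := by
  have := hP.isProbabilityMeasure
  have := Measure.isProbabilityMeasure_map (μ := P) (measurable_shift (X := X) a).aemeasurable
  have hgen := generateFrom_boxes (X := X) Set.univ
  rw [cylinderEvents_univ] at hgen
  refine ext_of_generate_finite _ hgen (isPiSystem_boxes _) ?_ (by simp)
  intro s hs
  obtain ⟨J, B, -, hB, rfl⟩ := exists_of_mem_boxes hs
  have hJ : {ω : ℝ → X | ∀ t ∈ J, ω t ∈ B t} = {ω | ∀ t ∈ J.sort, ω t ∈ B t} := by simp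
  rw [hJ, ← lintegral_indicator_one (measurableSet_box hB _),
    ← lintegral_indicator_one (measurableSet_box hB _), ← pathProd_boxList,
    lintegral_map (measurable_pathProd (measurable_of_mem_boxList hB)) (measurable_shift a),
    hP _ (measurable_of_mem_boxList hB) (boxList_pairwise B J), ← chain_shift _ a, ← hP]
  · simp [pathProd, shift, Function.comp_def]
  · intro p hp
    obtain ⟨q, hq, rfl⟩ := List.mem_map.1 hp
    exact measurable_of_mem_boxList hB q hq
  · rw [List.pairwise_map]
    exact (boxList_pairwise B J).imp fun h => by simpa using h

lemma IsChainLaw.measurePreserving_shift (hP : IsChainLaw κ μ P) (a : ℝ) :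
    MeasurePreserving (shift a) P P :=
  ⟨measurable_shift a, hP.map_shift a⟩

/-- **Markov property**: given the past up to time `r`, the conditional expectation of a product
of functions of later coordinates is the iterated integral started from the position at `r`. -/
lemma IsChainLaw.setLIntegral_pathProd (hP : IsChainLaw κ μ P) {L : List (ℝ × (X → ℝ≥0∞))}
    (hL : ∀ p ∈ L, Measurable p.2) (hs : L.Pairwise fun p q => p.1 < q.1) {r : ℝ}
    (hr : ∀ p ∈ L, r < p.1) (hfin : ∫⁻ ω, pathProd L ω ∂P ≠ ∞) {A : Set (ℝ → X)}
    (hA : MeasurableSet[cylinderEvents (X := fun _ : ℝ => X) (Set.Iic r)] A) :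
    ∫⁻ ω in A, pathProd L ω ∂P = ∫⁻ ω in A, chainFrom κ L r (ω r) ∂P := by
  classical
  have hpL := measurable_pathProd hL
  have hc : Measurable (chainFrom κ L r) := measurable_chainFrom hL r
  have hle : cylinderEvents (X := fun _ : ℝ => X) (Set.Iic r) ≤ MeasurableSpace.pi :=
    cylinderEvents_le_pi
  have key : ∀ (J : Finset ℝ) (B : ℝ → Set X), ↑J ⊆ Set.Iic r → (∀ t, MeasurableSet (B t)) →
      ∫⁻ ω in {ω | ∀ t ∈ J, ω t ∈ B t}, pathProd L ω ∂P =
        ∫⁻ ω in {ω | ∀ t ∈ J, ω t ∈ B t}, chainFrom κ L r (ω r) ∂P := by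
    intro J B hJ hB
    -- The time `r` is made the last time of the box, with the trivial constraint if `r ∉ J`, so
    -- that the later factors can be integrated out into the factor at `r`.
    let J' := J.erase r
    let B' : ℝ → Set X := fun t => if t ∈ J then B t else Set.univ
    have hB' : ∀ t, MeasurableSet (B' t) := fun t => by
      by_cases ht : t ∈ J <;> simp [B', ht, hB]
    have hset : {ω : ℝ → X | ∀ t ∈ J, ω t ∈ B t} = {ω | ∀ t ∈ J'.sort ++ [r], ω t ∈ B' t} := by
      ext ω
      simp only [Set.mem_ofPred_eq, List.mem_append, Finset.mem_sort, List.mem_singleton, B', J',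
        Finset.mem_erase]
      constructor
      · intro h t _
        by_cases ht : t ∈ J
        · simpa [ht] using h t ht
        · simp [ht]
      · intro h t ht
        have := h t (by by_cases h : t = r <;> simp [h, ht])
        simpa [ht] using this
    have hbox : boxList B' (J'.sort ++ [r]) = boxList B' J'.sort ++ [(r, (B' r).indicator 1)] := by
      simp [boxList]
    have hm := measurableSet_box hB' (J'.sort ++ [r])
    have hlt : ∀ p ∈ boxList B' J'.sort, p.1 < r := by
      intro p hp
      obtain ⟨t, ht, rfl⟩ := List.mem_map.1 hp
      rw [Finset.mem_sort, Finset.mem_erase] at ht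
      exact lt_of_le_of_ne (hJ ht.2) ht.1
    have hind : ∀ f : (ℝ → X) → ℝ≥0∞, ∫⁻ ω in {ω | ∀ t ∈ J, ω t ∈ B t}, f ω ∂P =
        ∫⁻ ω, pathProd (boxList B' J'.sort) ω * ((B' r).indicator 1 (ω r) * f ω) ∂P := by
      intro f
      rw [hset, ← lintegral_indicator hm]
      refine lintegral_congr fun ω => ?_
      have : {ω | ∀ t ∈ J'.sort ++ [r], ω t ∈ B' t}.indicator f ω =
          {ω | ∀ t ∈ J'.sort ++ [r], ω t ∈ B' t}.indicator 1 ω * f ω := by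
        by_cases h : ω ∈ {ω : ℝ → X | ∀ t ∈ J'.sort ++ [r], ω t ∈ B' t}
        · rw [Set.indicator_of_mem h, Set.indicator_of_mem h]; simp
        · rw [Set.indicator_of_notMem h, Set.indicator_of_notMem h]; simp
      rw [this, ← pathProd_boxList, hbox, pathProd_append, mul_assoc]
      simp [pathProd]
    rw [hind, hind]
    have h1 : ∀ ω : ℝ → X, pathProd (boxList B' J'.sort) ω *
        ((B' r).indicator 1 (ω r) * pathProd L ω) =
        pathProd (boxList B' J'.sort ++ (r, (B' r).indicator 1) :: L) ω := by
      intro ω; rw [pathProd_append]; simp [pathProd]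
    have h2 : ∀ ω : ℝ → X, pathProd (boxList B' J'.sort) ω *
        ((B' r).indicator 1 (ω r) * chainFrom κ L r (ω r)) =
        pathProd (boxList B' J'.sort ++
          [(r, fun y => (B' r).indicator 1 y * chainFrom κ L r y)]) ω := by
      intro ω; rw [pathProd_append]; simp [pathProd]
    have hmr : Measurable ((B' r).indicator (1 : X → ℝ≥0∞)) := measurable_one.indicator (hB' r)
    simp only [h1, h2]
    rw [hP, hP, chain_append]
    · intro p hp
      rcases List.mem_append.1 hp with hp | hp
      · exact measurable_of_mem_boxList hB' p hp
      · obtain rfl := List.mem_singleton.1 hp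
        exact hmr.mul hc
    · rw [List.pairwise_append]
      exact ⟨boxList_pairwise _ _, by simp, by simpa using fun a b hp => hlt (a, b) hp⟩
    · intro p hp
      rcases List.mem_append.1 hp with hp | hp
      · exact measurable_of_mem_boxList hB' p hp
      · rcases List.mem_cons.1 hp with rfl | hp
        · exact hmr
        · exact hL p hp
    · rw [List.pairwise_append]
      refine ⟨boxList_pairwise _ _, List.pairwise_cons.2 ⟨hr, hs⟩, fun p hp q hq => ?_⟩
      rcases List.mem_cons.1 hq with rfl | hq
      · exact hlt p hp
      · exact (hlt p hp).trans (hr q hq)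
  have hfin' : IsFiniteMeasure (P.withDensity (pathProd L)) :=
    isFiniteMeasure_withDensity hfin
  rw [← withDensity_apply _ (hle A hA), ← withDensity_apply _ (hle A hA)]
  refine ext_on_measurableSpace_of_generate_finite _ (boxes X (Set.Iic r)) ?_ hle
    (generateFrom_boxes _) (isPiSystem_boxes _) ?_ hA
  · intro s hs
    have hsm : MeasurableSet s := hle s (by
      rw [generateFrom_boxes]; exact MeasurableSpace.measurableSet_generateFrom hs)
    rw [withDensity_apply _ hsm, withDensity_apply _ hsm]
    obtain ⟨J, B, hJ, hB, rfl⟩ := exists_of_mem_boxes hs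
    exact key J B hJ hB
  · rw [withDensity_apply _ .univ, withDensity_apply _ .univ]
    simpa using key ∅ (fun _ => Set.univ) (by simp) (by simp)

/-- The joint law of a variable `Z` of the past up to time `r`, from which the position at `r` can
be read off by `c`, and of the position at a later time `u`. -/
lemma IsChainLaw.map_prodMk (h : IsStationaryFamily κ μ) (hP : IsChainLaw κ μ P)
    {E : Type*} [MeasurableSpace E] {r u : ℝ} (hru : r < u) {Z : (ℝ → X) → E}
    (hZ : Measurable[cylinderEvents (X := fun _ : ℝ => X) (Set.Iic r)] Z) {c : E → X}
    (hc : Measurable c) (hcZ : ∀ ω, c (Z ω) = ω r) :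
    P.map (fun ω => (Z ω, ω u)) = (P.map Z) ⊗ₘ ((κ (u - r).toNNReal).comap c hc) := by
  have := hP.isProbabilityMeasure
  have := h.markov
  have hZ' : Measurable Z := hZ.mono cylinderEvents_le_pi le_rfl
  have hm : Measurable fun ω : ℝ → X => (Z ω, ω u) := hZ'.prodMk (measurable_pi_apply u)
  have := Measure.isProbabilityMeasure_map (μ := P) hZ'.aemeasurable
  have := Measure.isProbabilityMeasure_map (μ := P) hm.aemeasurable
  refine Measure.ext_prod fun {A B} hA hB => ?_
  have hAm : MeasurableSet (Z ⁻¹' A) := hZ' hA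
  have hBm : MeasurableSet ((fun ω : ℝ → X => ω u) ⁻¹' B) := measurable_pi_apply u hB
  have hk : Measurable fun z => κ (u - r).toNNReal (c z) B :=
    ((κ (u - r).toNNReal).measurable_coe hB).comp hc
  rw [Measure.map_apply hm (hA.prod hB), Measure.compProd_apply_prod hA hB,
    setLIntegral_map hA (by simpa using hk) hZ']
  simp only [Kernel.comap_apply, hcZ]
  have hL : ∀ p ∈ [(u, B.indicator (1 : X → ℝ≥0∞))], Measurable p.2 := by
    simpa using measurable_one.indicator hB
  have hprod : ∀ ω : ℝ → X, pathProd [(u, B.indicator (1 : X → ℝ≥0∞))] ω =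
      ((fun ω : ℝ → X => ω u) ⁻¹' B).indicator 1 ω := fun ω => by
    simp only [pathProd, List.map_cons, List.map_nil, List.prod_cons, List.prod_nil, mul_one]
    rfl
  have := hP.setLIntegral_pathProd hL (by simp) (r := r) (by simpa using hru) (by
    simp only [hprod, lintegral_indicator_one hBm]; exact measure_ne_top _ _) (hZ hA)
  simp only [hprod, lintegral_indicator_one hBm, chainFrom, mul_one,
    lintegral_indicator_one hB] at this
  rw [Measure.restrict_apply hBm] at this
  rw [← this, Set.inter_comm]
  rfl

end Markov

/-! ### Harmonic functions and invariant events -/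

section General

variable {Ω : Type*} {m m0 : MeasurableSpace Ω} {P : Measure Ω}

lemma setIntegral_eq_of_generateFrom (hm : m ≤ m0) {C : Set (Set Ω)}
    (hgen : m = MeasurableSpace.generateFrom C) (hC : IsPiSystem C) {f g : Ω → ℝ}
    (hf : Integrable f P) (hg : Integrable g P) (hCs : ∀ s ∈ C, ∫ ω in s, f ω ∂P = ∫ ω in s, g ω ∂P)
    (huniv : ∫ ω, f ω ∂P = ∫ ω, g ω ∂P) {s : Set Ω} (hs : MeasurableSet[m] s) :
    ∫ ω in s, f ω ∂P = ∫ ω in s, g ω ∂P := by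
  induction s, hs using MeasurableSpace.induction_on_inter hgen hC with
  | empty => simp
  | basic s hs => exact hCs s hs
  | compl s hs ih =>
    have hf' := integral_add_compl (hm s hs) hf
    have hg' := integral_add_compl (hm s hs) hg
    linarith
  | iUnion s hd hs ih =>
    rw [integral_iUnion (fun i => hm _ (hs i)) hd hf.integrableOn,
      integral_iUnion (fun i => hm _ (hs i)) hd hg.integrableOn]
    simp only [ih]

/-- A set that is approximated by `m`-measurable sets is `m`-measurable up to a null set. -/
lemma indicator_ae_eq_condExp_of_approx [IsProbabilityMeasure P] (hm : m ≤ m0) {A : Set Ω}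
    (hA : MeasurableSet A)
    (happ : ∀ ε : ℝ, 0 < ε → ∃ C, MeasurableSet[m] C ∧ P (A ∆ C) ≤ ENNReal.ofReal ε) :
    A.indicator (fun _ => (1 : ℝ)) =ᵐ[P] P[A.indicator (fun _ => (1 : ℝ)) | m] := by
  set f : Ω → ℝ := A.indicator fun _ => 1
  have hf : Integrable f P := (integrable_const 1).indicator hA
  have hbound : ∀ ε : ℝ, 0 < ε → ∫ ω, |f ω - (P[f | m]) ω| ∂P ≤ ε := by
    intro ε hε
    obtain ⟨C, hC, hAC⟩ := happ (ε / 2) (by positivity)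
    set g : Ω → ℝ := C.indicator fun _ => 1
    have hg : Integrable g P := (integrable_const 1).indicator (hm C hC)
    have hgm : P[g | m] = g :=
      condExp_of_stronglyMeasurable hm (stronglyMeasurable_const.indicator hC) hg
    have hfg : ∫ ω, |(f - g) ω| ∂P ≤ ε / 2 := by
      have : ∀ ω, |(f - g) ω| = (A ∆ C).indicator (fun _ => (1 : ℝ)) ω := by
        intro ω
        by_cases h1 : ω ∈ A <;> by_cases h2 : ω ∈ C <;>
          simp [f, g, h1, h2, Set.mem_symmDiff]
      simp only [this]
      rw [integral_indicator_const _ (hA.symmDiff (hm C hC))]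
      simp only [smul_eq_mul, mul_one]
      exact ENNReal.toReal_le_of_le_ofReal (by positivity) hAC
    have hcond : P[f - g | m] =ᵐ[P] P[f | m] - g := by
      have := condExp_sub hf hg m
      rwa [hgm] at this
    calc ∫ ω, |f ω - (P[f | m]) ω| ∂P
        ≤ ∫ ω, (|(f - g) ω| + |(P[f - g | m]) ω|) ∂P := by
          refine integral_mono_ae (hf.sub integrable_condExp).abs
            ((hf.sub hg).abs.add integrable_condExp.abs) ?_
          filter_upwards [hcond] with ω hω
          rw [hω]
          simp only [Pi.sub_apply]
          calc |f ω - (P[f | m]) ω| = |(f ω - g ω) - ((P[f | m]) ω - g ω)| := by ring_nf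
            _ ≤ _ := abs_sub _ _
      _ = ∫ ω, |(f - g) ω| ∂P + ∫ ω, |(P[f - g | m]) ω| ∂P :=
          integral_add (hf.sub hg).abs integrable_condExp.abs
      _ ≤ ε / 2 + ε / 2 := add_le_add hfg ((integral_abs_condExp_le _).trans hfg)
      _ = ε := by ring
  have hzero : ∫ ω, |f ω - (P[f | m]) ω| ∂P = 0 :=
    le_antisymm (le_of_forall_pos_le_add fun ε hε => by simpa using hbound ε hε)
      (integral_nonneg fun ω => abs_nonneg _)
  have habs : Integrable (fun ω => |f ω - (P[f | m]) ω|) P := (hf.sub integrable_condExp).abs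
  rw [integral_eq_zero_iff_of_nonneg (fun ω => abs_nonneg _) habs] at hzero
  filter_upwards [hzero] with ω hω
  exact sub_eq_zero.1 (abs_eq_zero.1 hω)

end General

section Ergodic

variable {X : Type*} [MeasurableSpace X]
variable {κ : ℝ≥0 → Kernel X X} {μ : Measure X} {P : Measure (ℝ → X)}

lemma IsChainLaw.map_pair (h : IsStationaryFamily κ μ) (hP : IsChainLaw κ μ P) {t : ℝ≥0}
    (ht : 0 < t) : P.map (fun ω => (ω 0, ω t)) = μ ⊗ₘ κ t := by
  have hZ : Measurable[cylinderEvents (X := fun _ : ℝ => X) (Set.Iic 0)] fun ω : ℝ → X => ω 0 :=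
    measurable_cylinderEvent_apply (Set.mem_Iic.2 le_rfl)
  have := hP.map_prodMk h (u := (t : ℝ)) (by exact_mod_cast ht) hZ measurable_id fun ω => rfl
  rw [this, hP.map_eval]
  simp

/-- For a bounded function that is harmonic almost everywhere, expanding the square gives
`E|φ(X_t) - φ(X_0)|² = 0`. -/
lemma IsChainLaw.ae_eq_of_harmonic (h : IsStationaryFamily κ μ) (hP : IsChainLaw κ μ P)
    {φ : X → ℝ} (hφ : IsLb φ) {t : ℝ≥0} (ht : 0 < t)
    (hharm : ∀ᵐ x ∂μ, ∫ y, φ y ∂(κ t x) = φ x) :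
    ∀ᵐ ω ∂P, φ (ω t) = φ (ω 0) := by
  have := hP.isProbabilityMeasure
  have := h.prob
  have := h.markov
  obtain ⟨hm, C, hC⟩ := hφ
  have hb2 : ∀ a b, |φ a * φ b| ≤ C * C := fun a b => by
    rw [abs_mul]; exact mul_le_mul (hC a) (hC b) (abs_nonneg _) ((abs_nonneg _).trans (hC a))
  have hint : ∀ s u : ℝ, Integrable (fun ω : ℝ → X => φ (ω s) * φ (ω u)) P := fun s u =>
    .of_bound (by fun_prop) (C * C) (.of_forall fun ω => hb2 _ _)
  have hsq : ∀ s : ℝ, ∫ ω, φ (ω s) * φ (ω s) ∂P = ∫ x, φ x * φ x ∂μ := fun s => by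
    rw [← hP.map_eval s, integral_map (measurable_pi_apply s).aemeasurable
      (by fun_prop)]
  have hcross : ∫ ω, φ (ω 0) * φ (ω t) ∂P = ∫ x, φ x * φ x ∂μ := by
    have hmp : Measurable fun ω : ℝ → X => (ω 0, ω (t : ℝ)) := by fun_prop
    have h1 : ∫ ω, φ (ω 0) * φ (ω t) ∂P = ∫ p, φ p.1 * φ p.2 ∂(μ ⊗ₘ κ t) := by
      rw [← hP.map_pair h ht, integral_map hmp.aemeasurable (by fun_prop)]
    rw [h1, Measure.integral_compProd
      (.of_bound (by fun_prop) (C * C) (.of_forall fun p => hb2 _ _))]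
    refine integral_congr_ae ?_
    filter_upwards [hharm] with x hx
    rw [integral_const_mul, hx]
  have hzero : ∫ ω, (φ (ω t) - φ (ω 0)) ^ 2 ∂P = 0 := by
    have : ∀ ω : ℝ → X, (φ (ω t) - φ (ω 0)) ^ 2 =
        φ (ω t) * φ (ω t) + φ (ω 0) * φ (ω 0) - 2 * (φ (ω 0) * φ (ω t)) := fun ω => by ring
    simp only [this]
    have hadd : Integrable (fun ω : ℝ → X => φ (ω t) * φ (ω t) + φ (ω 0) * φ (ω 0)) P :=
      (hint _ _).add (hint _ _)
    rw [integral_sub hadd ((hint _ _).const_mul 2),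
      integral_add (hint _ _) (hint _ _), integral_const_mul, hsq, hsq, hcross]
    ring
  have hint2 : Integrable (fun ω : ℝ → X => (φ (ω t) - φ (ω 0)) ^ 2) P :=
    .of_bound (by fun_prop) ((2 * C) ^ 2) (.of_forall fun ω => by
      rw [Real.norm_eq_abs, abs_pow]
      refine pow_le_pow_left₀ (abs_nonneg _) ?_ 2
      calc |φ (ω t) - φ (ω 0)| ≤ |φ (ω t)| + |φ (ω 0)| := abs_sub _ _
        _ ≤ 2 * C := by linarith [hC (ω t), hC (ω 0)])
  rw [integral_eq_zero_iff_of_nonneg (fun ω => sq_nonneg _) hint2] at hzero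
  filter_upwards [hzero] with ω hω
  exact sub_eq_zero.1 (pow_eq_zero_iff two_ne_zero |>.1 hω)

/-- Negative times are reduced to positive ones by shifting paths. -/
lemma IsChainLaw.ae_eq_of_harmonic_all (h : IsStationaryFamily κ μ) (hP : IsChainLaw κ μ P)
    {φ : X → ℝ} (hφ : IsLb φ) (hharm : ∀ t : ℝ≥0, ∀ᵐ x ∂μ, ∫ y, φ y ∂(κ t x) = φ x) (t : ℝ) :
    ∀ᵐ ω ∂P, φ (ω t) = φ (ω 0) := by
  rcases lt_trichotomy t 0 with ht | rfl | ht
  · have h1 := hP.ae_eq_of_harmonic h hφ (t := ⟨-t, by linarith⟩)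
      (by exact_mod_cast (neg_pos.2 ht)) (hharm _)
    filter_upwards [(hP.measurePreserving_shift t).quasiMeasurePreserving.ae h1] with ω hω
    change φ (ω (t + -t)) = φ (ω (t + 0)) at hω
    rw [add_neg_cancel, add_zero] at hω
    exact hω.symm
  · exact .of_forall fun ω => rfl
  · exact hP.ae_eq_of_harmonic h hφ (t := ⟨t, ht.le⟩) (by exact_mod_cast ht) (hharm _)

/-- Events invariant under all shifts are, up to null sets, events of the times in `Δ`, as soon as
each finite set of times can be shifted into `Δ`. -/
lemma IsChainLaw.indicator_ae_eq_condExp (hP : IsChainLaw κ μ P) {A : Set (ℝ → X)}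
    (hA : MeasurableSet A) (hinv : ∀ t : ℝ, shift t ⁻¹' A =ᵐ[P] A) {Δ : Set ℝ}
    (hΔ : ∀ I : Finset ℝ, ∃ a : ℝ, ∀ i ∈ I, a + i ∈ Δ) :
    A.indicator (fun _ => (1 : ℝ)) =ᵐ[P]
      P[A.indicator (fun _ => (1 : ℝ)) | cylinderEvents (X := fun _ : ℝ => X) Δ] := by
  have := hP.isProbabilityMeasure
  refine indicator_ae_eq_condExp_of_approx cylinderEvents_le_pi hA fun ε hε => ?_
  obtain ⟨C, hC, hAC⟩ := (Measure.MeasureDense.of_generateFrom_isSetAlgebra_finite P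
    (isSetAlgebra_measurableCylinders (α := fun _ : ℝ => X))
    generateFrom_measurableCylinders.symm).approx A hA (measure_ne_top _ _) ε hε
  obtain ⟨I, S, hS, rfl⟩ := (mem_measurableCylinders C).1 hC
  obtain ⟨a, ha⟩ := hΔ I
  refine ⟨shift a ⁻¹' cylinder I S, ?_, ?_⟩
  · have : Measurable[cylinderEvents (X := fun _ : ℝ => X) Δ] fun ω : ℝ → X =>
        I.restrict (shift a ω) := by
      refine @measurable_pi_lambda _ _ _ (_) _ _ fun i => ?_
      exact measurable_cylinderEvent_apply (ha i i.2)
    exact this hS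
  · have h1 : (A ∆ (shift a ⁻¹' cylinder I S) : Set (ℝ → X)) =ᵐ[P]
        shift a ⁻¹' (A ∆ cylinder I S) := by
      rw [Set.preimage_symmDiff]
      exact (hinv a).symm.symmDiff (ae_eq_refl _)
    rw [measure_congr h1, (hP.measurePreserving_shift a).measure_preimage
      (hA.symmDiff (hS.cylinder I)).nullMeasurableSet]
    exact hAC.le

end Ergodic

/-! ### Conditional independence of past and future -/

section PastFuture

variable {X : Type*} [MeasurableSpace X]
variable {κ : ℝ≥0 → Kernel X X} {μ : Measure X} {P : Measure (ℝ → X)}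

/-- The `σ`-algebra of events before time `0`. -/
abbrev pastEvents (X : Type*) [MeasurableSpace X] : MeasurableSpace (ℝ → X) :=
  cylinderEvents (X := fun _ : ℝ => X) (Set.Iic 0)

/-- The `σ`-algebra of events after time `0`. -/
abbrev futureEvents (X : Type*) [MeasurableSpace X] : MeasurableSpace (ℝ → X) :=
  cylinderEvents (X := fun _ : ℝ => X) (Set.Ici 0)

/-- The `σ`-algebra of events at time `0`. -/
abbrev presentEvents (X : Type*) [MeasurableSpace X] : MeasurableSpace (ℝ → X) :=
  MeasurableSpace.comap (fun ω : ℝ → X => ω 0) ‹_›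

lemma presentEvents_le_past : presentEvents X ≤ pastEvents X :=
  (measurable_cylinderEvent_apply (X := fun _ : ℝ => X) (Set.mem_Iic.2 le_rfl)).comap_le

lemma presentEvents_le_future : presentEvents X ≤ futureEvents X :=
  (measurable_cylinderEvent_apply (X := fun _ : ℝ => X) (Set.mem_Ici.2 le_rfl)).comap_le

/-- The conditional probability of a box in the future, given the past, depends on the present
only. -/
lemma IsChainLaw.exists_condExp_box (hP : IsChainLaw κ μ P) {s : Set (ℝ → X)}
    (hs : s ∈ boxes X (Set.Ici 0)) :
    ∃ w : (ℝ → X) → ℝ, StronglyMeasurable[presentEvents X] w ∧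
      P[s.indicator (fun _ => (1 : ℝ)) | pastEvents X] =ᵐ[P] w := by
  classical
  have := hP.isProbabilityMeasure
  obtain ⟨J, B, hJ, hB, rfl⟩ := exists_of_mem_boxes hs
  let J' := J.erase 0
  let D : Set X := if (0 : ℝ) ∈ J then B 0 else Set.univ
  have hD : MeasurableSet D := by by_cases h : (0 : ℝ) ∈ J <;> simp [D, h, hB]
  let L := boxList B J'.sort
  have hL : ∀ p ∈ L, Measurable p.2 := measurable_of_mem_boxList hB
  let T : Set (ℝ → X) := {ω | ∀ t ∈ J'.sort, ω t ∈ B t}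
  have hT : MeasurableSet T := measurableSet_box hB _
  have hLT : pathProd L = T.indicator 1 := pathProd_boxList B _
  have hset : {ω : ℝ → X | ∀ t ∈ J, ω t ∈ B t} = {ω | ω 0 ∈ D} ∩ T := by
    ext ω
    simp only [Set.mem_ofPred_eq, Set.mem_inter_iff, D, T, J', Finset.mem_sort, Finset.mem_erase]
    constructor
    · intro h
      refine ⟨?_, fun t ht => h t ht.2⟩
      by_cases h0 : (0 : ℝ) ∈ J
      · simpa [h0] using h 0 h0
      · simp [h0]
    · intro h t ht
      by_cases h0 : t = 0
      · subst h0; simpa [ht] using h.1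
      · exact h.2 t ⟨h0, ht⟩
  have hlt : ∀ p ∈ L, 0 < p.1 := by
    intro p hp
    obtain ⟨t, ht, rfl⟩ := List.mem_map.1 hp
    rw [Finset.mem_sort, Finset.mem_erase] at ht
    exact lt_of_le_of_ne (hJ ht.2) (Ne.symm ht.1)
  have hfin : ∫⁻ ω, pathProd L ω ∂P ≠ ∞ := by
    rw [hLT, lintegral_indicator_one hT]; exact measure_ne_top _ _
  have hmark := fun A hA => hP.setLIntegral_pathProd hL (boxList_pairwise B J') hlt hfin (A := A) hA
  have hc : Measurable (chainFrom κ L 0) := measurable_chainFrom hL 0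
  have hcω : Measurable fun ω : ℝ → X => chainFrom κ L 0 (ω 0) := hc.comp (measurable_pi_apply 0)
  have hcfin : ∫⁻ ω, chainFrom κ L 0 (ω 0) ∂P ≠ ∞ := by
    have := hmark Set.univ .univ
    rw [setLIntegral_univ, setLIntegral_univ] at this
    rwa [← this]
  let w₀ : X → ℝ := D.indicator fun x => (chainFrom κ L 0 x).toReal
  have hw₀ : Measurable w₀ := hc.ennreal_toReal.indicator hD
  have hwint : Integrable (fun ω : ℝ → X => w₀ (ω 0)) P :=
    (integrable_toReal_of_lintegral_ne_top hcω.aemeasurable hcfin).indicator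
      (measurable_pi_apply 0 hD)
  have hDpast : MeasurableSet[pastEvents X] {ω : ℝ → X | ω 0 ∈ D} :=
    presentEvents_le_past _ ⟨D, hD, rfl⟩
  have hD' : MeasurableSet {ω : ℝ → X | ω 0 ∈ D} := measurable_pi_apply 0 hD
  refine ⟨fun ω => w₀ (ω 0), (hw₀.comp (comap_measurable _)).stronglyMeasurable, ?_⟩
  refine (ae_eq_condExp_of_forall_setIntegral_eq cylinderEvents_le_pi
    ((integrable_const 1).indicator (hset ▸ hD'.inter hT)) (fun _ _ _ => hwint.integrableOn) ?_
    (((hw₀.comp (comap_measurable _)).stronglyMeasurable.mono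
      presentEvents_le_past).aestronglyMeasurable)).symm
  intro A hA _
  have hA' : MeasurableSet A := cylinderEvents_le_pi A hA
  have h1 : ∀ ω : ℝ → X, w₀ (ω 0) =
      {ω : ℝ → X | ω 0 ∈ D}.indicator (fun ω => (chainFrom κ L 0 (ω 0)).toReal) ω := fun ω => rfl
  simp only [h1]
  have hae := ae_lt_top hcω hcfin
  rw [setIntegral_indicator hD', integral_toReal hcω.aemeasurable.restrict
    (ae_restrict_of_ae hae), ← hmark _ (hA.inter hDpast), hLT, lintegral_indicator_one hT, hset,
    setIntegral_indicator (hD'.inter hT)]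
  rw [integral_const, smul_eq_mul, mul_one, Measure.real, Measure.restrict_apply .univ,
    Set.univ_inter, Measure.restrict_apply hT, Set.inter_comm T, Set.inter_assoc]

/-- Given the present, a variable of the past is conditionally independent of the future. -/
lemma IsChainLaw.condExp_future_eq (hP : IsChainLaw κ μ P) {g : (ℝ → X) → ℝ}
    (hg : Integrable g P) (hgm : StronglyMeasurable[pastEvents X] g) :
    P[g | futureEvents X] =ᵐ[P] P[g | presentEvents X] := by
  have := hP.isProbabilityMeasure
  have hpast : pastEvents X ≤ MeasurableSpace.pi := cylinderEvents_le_pi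
  have hfut : futureEvents X ≤ MeasurableSpace.pi := cylinderEvents_le_pi
  have hpres : presentEvents X ≤ MeasurableSpace.pi := presentEvents_le_past.trans hpast
  refine (ae_eq_condExp_of_forall_setIntegral_eq hfut hg
    (fun _ _ _ => integrable_condExp.integrableOn) (fun s hs _ => ?_)
    (stronglyMeasurable_condExp.mono presentEvents_le_future).aestronglyMeasurable).symm
  refine setIntegral_eq_of_generateFrom hfut (generateFrom_boxes _) (isPiSystem_boxes _)
    integrable_condExp hg (fun s hs => ?_) (integral_condExp hpres) hs
  obtain ⟨w, hwm, hw⟩ := hP.exists_condExp_box hs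
  have hsm : MeasurableSet s := hfut s (by
    rw [futureEvents, generateFrom_boxes]; exact MeasurableSpace.measurableSet_generateFrom hs)
  have hone : Integrable (s.indicator fun _ => (1 : ℝ)) P := (integrable_const 1).indicator hsm
  have hmul : ∀ f : (ℝ → X) → ℝ, (f * s.indicator fun _ => (1 : ℝ)) = s.indicator f := by
    intro f; ext ω
    by_cases h : ω ∈ s <;> simp [h]
  -- Conditioning on the past replaces the indicator of the box by the function `w` of the present.
  have key : ∀ f : (ℝ → X) → ℝ, Integrable f P → StronglyMeasurable[pastEvents X] f →
      Integrable (f * w) P ∧ ∫ ω in s, f ω ∂P = ∫ ω, (f * w) ω ∂P := by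
    intro f hf hfm
    have hi : Integrable (f * s.indicator fun _ => (1 : ℝ)) P := by
      rw [hmul]; exact hf.indicator hsm
    have h1 : P[f * s.indicator (fun _ => (1 : ℝ)) | pastEvents X] =ᵐ[P] f * w :=
      (condExp_mul_of_stronglyMeasurable_left hfm hi hone).trans
        ((EventuallyEq.refl _ f).mul hw)
    refine ⟨integrable_condExp.congr h1, ?_⟩
    rw [← integral_congr_ae h1, integral_condExp hpast, hmul, integral_indicator hsm]
  obtain ⟨hgw, hgs⟩ := key g hg hgm
  obtain ⟨-, hps⟩ := key _ (integrable_condExp (m := presentEvents X) (f := g))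
    (stronglyMeasurable_condExp.mono presentEvents_le_past)
  rw [hgs, hps, ← integral_condExp hpres (f := g * w)]
  exact integral_congr_ae (condExp_mul_of_stronglyMeasurable_right hwm hgw hg).symm

/-- A shift-invariant event is, up to a null set, determined by the position at time `0`: it is
measurable with respect to the past as well as to the future, which are conditionally independent
given the present. -/
theorem IsChainLaw.exists_eq_present (hP : IsChainLaw κ μ P) {A : Set (ℝ → X)}
    (hA : MeasurableSet A) (hinv : ∀ t : ℝ, shift t ⁻¹' A =ᵐ[P] A) :
    ∃ B : Set X, MeasurableSet B ∧ A =ᵐ[P] {ω | ω 0 ∈ B} := by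
  have := hP.isProbabilityMeasure
  have hf : Integrable (A.indicator fun _ => (1 : ℝ)) P := (integrable_const 1).indicator hA
  have hplus := hP.indicator_ae_eq_condExp hA hinv (Δ := Set.Ici 0) fun I => by
    obtain ⟨b, hb⟩ := I.bddBelow
    exact ⟨-b, fun i hi => by have := hb hi; simp only [Set.mem_Ici]; linarith⟩
  have hminus := hP.indicator_ae_eq_condExp hA hinv (Δ := Set.Iic 0) fun I => by
    obtain ⟨b, hb⟩ := I.bddAbove
    exact ⟨-b, fun i hi => by have := hb hi; simp only [Set.mem_Iic]; linarith⟩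
  set f : (ℝ → X) → ℝ := A.indicator fun _ => 1
  have hpres : f =ᵐ[P] P[P[f | pastEvents X] | presentEvents X] :=
    hplus.trans ((condExp_congr_ae hminus).trans
      (hP.condExp_future_eq integrable_condExp stronglyMeasurable_condExp))
  obtain ⟨φ, hφ, hφeq⟩ := (stronglyMeasurable_condExp (m := presentEvents X)
    (f := P[f | pastEvents X]) (μ := P)).measurable.exists_eq_measurable_comp
  refine ⟨φ ⁻¹' {1}, hφ (measurableSet_singleton 1), ?_⟩
  filter_upwards [hpres] with ω hω
  rw [hφeq] at hω
  refine propext ?_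
  change ω ∈ A ↔ φ (ω 0) = 1
  rw [Function.comp_apply] at hω
  rw [← hω]
  by_cases h : ω ∈ A <;> simp [f, h]

/-- The set of positions that determines an invariant event is closed under the transitions. -/
theorem IsChainLaw.ae_mem_iff_of_invariant (h : IsStationaryFamily κ μ) (hP : IsChainLaw κ μ P)
    {A : Set (ℝ → X)} (hinv : ∀ t : ℝ, shift t ⁻¹' A =ᵐ[P] A) {B : Set X} (hB : MeasurableSet B)
    (hAB : A =ᵐ[P] {ω | ω 0 ∈ B}) {t : ℝ≥0} (ht : 0 < t) :
    ∀ᵐ x ∂μ, ∀ᵐ y ∂(κ t x), (y ∈ B ↔ x ∈ B) := by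
  have := h.prob
  have := h.markov
  have h1 : ∀ᵐ ω ∂P, (ω t ∈ B ↔ ω 0 ∈ B) := by
    have hs := (hP.measurePreserving_shift t).quasiMeasurePreserving.ae (hAB.mem_iff)
    filter_upwards [hs, hAB.mem_iff, (hinv t).mem_iff] with ω h1 h2 h3
    simp only [Set.mem_preimage, shift, add_zero] at h1 h2 h3
    rw [← h1, ← h2]
    exact h3
  have hmp : Measurable fun ω : ℝ → X => (ω 0, ω (t : ℝ)) := by fun_prop
  have hms : MeasurableSet {p : X × X | p.2 ∈ B ↔ p.1 ∈ B} :=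
    MeasurableSet.iff (p := fun p : X × X => p.2 ∈ B) (q := fun p => p.1 ∈ B)
      (measurable_snd hB) (measurable_fst hB)
  have h2 : ∀ᵐ p ∂(μ ⊗ₘ κ t), (p.2 ∈ B ↔ p.1 ∈ B) := by
    rw [← hP.map_pair h ht, ae_map_iff hmp.aemeasurable hms]
    exact h1
  exact Measure.ae_ae_of_ae_compProd h2

end PastFuture

/-! ### The kernels of the semigroup -/

section Linear

variable {α : Type*} [MeasurableSpace α]

lemma isLb_indicator {s : Set α} (hs : MeasurableSet s) :
    IsLb (s.indicator fun _ => (1 : ℝ)) :=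
  ⟨measurable_const.indicator hs, 1, fun x => by by_cases h : x ∈ s <;> simp [h]⟩

lemma IsLb.neg {f : α → ℝ} (hf : IsLb f) : IsLb fun x => -f x :=
  ⟨hf.1.neg, hf.2.imp fun C hC x => by rw [abs_neg]; exact hC x⟩

lemma IsLb.integrable {f : α → ℝ} (hf : IsLb f) (μ : Measure α) [IsFiniteMeasure μ] :
    Integrable f μ := by
  obtain ⟨hm, C, hC⟩ := hf
  exact .of_bound hm.aestronglyMeasurable C (.of_forall hC)

/-- An upper expectation that is linear on the indicators of a generating π-system is the
expectation under a single probability measure. -/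
lemma IsUpperExpectation.exists_eq_integral {E : (α → ℝ) → ℝ} (hE : IsUpperExpectation E)
    {C : Set (Set α)} (hgen : ‹MeasurableSpace α› = MeasurableSpace.generateFrom C)
    (hC : IsPiSystem C) (hlin : ∀ s ∈ C, E (s.indicator fun _ => (1 : ℝ)) =
      -E (fun x => -s.indicator (fun _ => (1 : ℝ)) x)) :
    ∃ Q : ProbabilityMeasure α, ∀ φ, IsLb φ → E φ = ∫ x, φ x ∂(Q : Measure α) := by
  obtain ⟨S, hS⟩ := hE
  obtain ⟨Q, hQ⟩ : S.Nonempty := by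
    by_contra hne
    rw [Set.not_nonempty_iff_eq_empty] at hne
    have := hS (fun _ => 0) ⟨measurable_const, 0, by simp⟩
    rw [hne, Set.image_empty] at this
    exact not_isBot _ (isLUB_empty_iff.1 this)
  have hval : ∀ Q' ∈ S, ∀ s ∈ C, (Q' : Measure α).real s = E (s.indicator fun _ => (1 : ℝ)) := by
    intro Q' hQ' s hs
    have hsm : MeasurableSet s := by
      rw [hgen]; exact MeasurableSpace.measurableSet_generateFrom hs
    have hi : ∫ x, s.indicator (fun _ => (1 : ℝ)) x ∂(Q' : Measure α) =
        (Q' : Measure α).real s := by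
      rw [integral_indicator_const _ hsm]; simp
    have h1 := (hS _ (isLb_indicator hsm)).1 ⟨Q', hQ', rfl⟩
    have h2 := (hS _ (isLb_indicator hsm).neg).1 ⟨Q', hQ', rfl⟩
    simp only [integral_neg, hi] at h1 h2
    linarith [hlin s hs]
  have huniq : ∀ Q' ∈ S, Q' = Q := by
    intro Q' hQ'
    have heq : (Q' : Measure α) = Q := by
      refine ext_of_generate_finite C hgen hC (fun s hs => ?_) (by simp)
      rw [← ENNReal.toReal_eq_toReal_iff' (measure_ne_top _ _) (measure_ne_top _ _)]
      exact (hval Q' hQ' s hs).trans (hval Q hQ s hs).symm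
    exact Subtype.ext heq
  have hSQ : S = {Q} := Set.eq_singleton_iff_unique_mem.2 ⟨hQ, huniq⟩
  refine ⟨Q, fun φ hφ => ?_⟩
  have := hS φ hφ
  rw [hSQ, Set.image_singleton] at this
  exact this.unique isLUB_singleton

lemma IsUpperExpectation.add_neg_nonneg {E : (α → ℝ) → ℝ} (hE : IsUpperExpectation E)
    {φ : α → ℝ} (hφ : IsLb φ) : 0 ≤ E φ + E (fun x => -φ x) := by
  obtain ⟨S, hS⟩ := hE
  by_cases hne : S.Nonempty
  · obtain ⟨Q, hQ⟩ := hne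
    have h1 := (hS _ hφ).1 ⟨Q, hQ, rfl⟩
    have h2 := (hS _ hφ.neg).1 ⟨Q, hQ, rfl⟩
    simp only [integral_neg] at h1 h2
    linarith
  · rw [Set.not_nonempty_iff_eq_empty] at hne
    have := hS φ hφ
    rw [hne, Set.image_empty] at this
    exact absurd (isLUB_empty_iff.1 this) (not_isBot _)

end Linear

section Kernel

variable {X : Type*} [MeasurableSpace X] {T : ℝ≥0 → (X → ℝ) → X → ℝ} {T' : (X → ℝ) → ℝ}
  {μ : Measure X} [IsProbabilityMeasure μ]

lemma holdsAS_iff (hμ : ∀ φ, IsLb φ → T' φ = ∫ x, φ x ∂μ) {p : X → Prop} :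
    HoldsAS T' p ↔ ∀ᵐ x ∂μ, p x := by
  have h1 : ∀ N : Set X, MeasurableSet N → (T' (N.indicator fun _ => 1) = 0 ↔ μ N = 0) := by
    intro N hN
    rw [hμ _ (isLb_indicator hN), integral_indicator_const _ hN]
    simp [measureReal_eq_zero_iff]
  constructor
  · rintro ⟨N, hN, hN0, hp⟩
    exact measure_mono_null (fun x hx => by by_contra h; exact hx (hp x h)) ((h1 N hN).1 hN0)
  · intro hp
    obtain ⟨N, hsub, hN, hN0⟩ := exists_measurable_superset_of_null (ae_iff.1 hp)
    exact ⟨N, hN, (h1 N hN).2 hN0, fun x hx => by by_contra h; exact hx (hsub h)⟩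

/-- Since `∫ (T_t φ + T_t (-φ)) dμ = ∫ φ dμ - ∫ φ dμ = 0`, the semigroup is linear `μ`-almost
everywhere. -/
lemma ae_eq_neg (hT : IsSublinearMarkovSemigroup T)
    (hTrep : ∀ t x, IsUpperExpectation fun φ => T t φ x) (hT' : IsInvariantExpectation T T')
    (hμ : ∀ φ, IsLb φ → T' φ = ∫ x, φ x ∂μ) (t : ℝ≥0) {φ : X → ℝ} (hφ : IsLb φ) :
    ∀ᵐ x ∂μ, T t φ x = -T t (fun y => -φ y) x := by
  have hval : ∀ ψ, IsLb ψ → ∫ x, T t ψ x ∂μ = ∫ x, ψ x ∂μ := fun ψ hψ => by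
    rw [← hμ _ (hT.maps t ψ hψ), hT'.invariant t ψ hψ, hμ ψ hψ]
  have hi1 := (hT.maps t φ hφ).integrable μ
  have hi2 := (hT.maps t _ hφ.neg).integrable μ
  have hzero : ∫ x, (T t φ x + T t (fun y => -φ y) x) ∂μ = 0 := by
    rw [integral_add hi1 hi2, hval φ hφ, hval _ hφ.neg, integral_neg]
    ring
  have hi : Integrable (fun x => T t φ x + T t (fun y => -φ y) x) μ := hi1.add hi2
  rw [integral_eq_zero_iff_of_nonneg (fun x => (hTrep t x).add_neg_nonneg hφ) hi] at hzero
  filter_upwards [hzero] with x hx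
  exact eq_neg_of_add_eq_zero_left hx

/-- At `μ`-almost every point all measures representing `T_t` coincide, because they coincide on a
countable generating algebra. -/
lemma ae_exists_eq_integral [MeasurableSpace.CountablyGenerated X]
    (hT : IsSublinearMarkovSemigroup T)
    (hTrep : ∀ t x, IsUpperExpectation fun φ => T t φ x) (hT' : IsInvariantExpectation T T')
    (hμ : ∀ φ, IsLb φ → T' φ = ∫ x, φ x ∂μ) (t : ℝ≥0) :
    ∀ᵐ x ∂μ, ∃ Q : ProbabilityMeasure X, ∀ φ, IsLb φ → T t φ x = ∫ y, φ y ∂(Q : Measure X) := by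
  let C : Set (Set X) := generateSetAlgebra (MeasurableSpace.countableGeneratingSet X)
  have hCc : C.Countable :=
    countable_generateSetAlgebra MeasurableSpace.countable_countableGeneratingSet
  have hgen : ‹MeasurableSpace X› = MeasurableSpace.generateFrom C := by
    rw [generateFrom_generateSetAlgebra_eq,
      MeasurableSpace.generateFrom_countableGeneratingSet]
  have hCm : ∀ s ∈ C, MeasurableSet s := fun s hs => by
    rw [hgen]; exact MeasurableSpace.measurableSet_generateFrom hs
  have hC : IsPiSystem C := isSetAlgebra_generateSetAlgebra.isSetRing.isSetSemiring.isPiSystem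
  have hae := (ae_ball_iff hCc).2 fun s hs =>
    ae_eq_neg hT hTrep hT' hμ t (isLb_indicator (hCm s hs))
  filter_upwards [hae] with x hx
  exact (hTrep t x).exists_eq_integral hgen hC hx

/-- Almost everywhere, the semigroup is given by Markov kernels. -/
lemma exists_kernel [MeasurableSpace.CountablyGenerated X]
    (hT : IsSublinearMarkovSemigroup T)
    (hTrep : ∀ t x, IsUpperExpectation fun φ => T t φ x) (hT' : IsInvariantExpectation T T')
    (hμ : ∀ φ, IsLb φ → T' φ = ∫ x, φ x ∂μ) (t : ℝ≥0) :
    ∃ κ : Kernel X X, IsMarkovKernel κ ∧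
      ∀ᵐ x ∂μ, ∀ φ, IsLb φ → T t φ x = ∫ y, φ y ∂(κ x) := by
  classical
  have hae := ae_exists_eq_integral hT hTrep hT' hμ t
  obtain ⟨N, hsub, hN, hN0⟩ := exists_measurable_superset_of_null (ae_iff.1 hae)
  have hex : ∀ x, ∃ Q : ProbabilityMeasure X, x ∉ N →
      ∀ φ, IsLb φ → T t φ x = ∫ y, φ y ∂(Q : Measure X) := by
    intro x
    by_cases hx : x ∈ N
    · exact ⟨⟨Measure.dirac x, inferInstance⟩, fun h => absurd hx h⟩
    · have : ∃ Q : ProbabilityMeasure X, ∀ φ, IsLb φ → T t φ x = ∫ y, φ y ∂(Q : Measure X) := by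
        by_contra h; exact hx (hsub h)
      exact this.imp fun Q hQ _ => hQ
  choose Q hQ using hex
  -- On the null set `N` the value of the kernel is immaterial; `dirac x` keeps it Markov.
  let k : X → Measure X := fun x => if x ∈ N then Measure.dirac x else Q x
  have hk : Measurable k := by
    refine Measure.measurable_of_measurable_coe _ fun B hB => ?_
    have : (fun x => k x B) = fun x => if x ∈ N then B.indicator 1 x else
        ENNReal.ofReal (T t (B.indicator fun _ => 1) x) := by
      ext x
      by_cases hx : x ∈ N
      · simp [k, hx, hB]
      · simp only [k, hx, if_false]
        rw [hQ x hx _ (isLb_indicator hB), integral_indicator_const _ hB]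
        simp
    rw [this]
    exact Measurable.ite hN (measurable_one.indicator hB)
      (hT.maps t _ (isLb_indicator hB)).1.ennreal_ofReal
  refine ⟨⟨k, hk⟩, ⟨fun x => ?_⟩, ?_⟩
  · change IsProbabilityMeasure (k x)
    by_cases hx : x ∈ N <;> simp only [k, hx, if_true, if_false] <;> infer_instance
  · filter_upwards [measure_eq_zero_iff_ae_notMem.1 hN0] with x hx φ hφ
    change _ = ∫ y, φ y ∂(k x)
    simp only [k, hx, if_false]
    exact hQ x hx φ hφ

lemma isStationaryFamily_of_semigroup (hT : IsSublinearMarkovSemigroup T)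
    (hT' : IsInvariantExpectation T T') (hμ : ∀ φ, IsLb φ → T' φ = ∫ x, φ x ∂μ)
    {κ : ℝ≥0 → Kernel X X} (hκ : ∀ t, IsMarkovKernel (κ t))
    (hκT : ∀ t, ∀ᵐ x ∂μ, ∀ φ, IsLb φ → T t φ x = ∫ y, φ y ∂(κ t x)) :
    IsStationaryFamily κ μ := by
  have hval : ∀ t, ∀ᵐ x ∂μ, ∀ B, MeasurableSet B →
      κ t x B = ENNReal.ofReal (T t (B.indicator fun _ => 1) x) := by
    intro t
    filter_upwards [hκT t] with x hx B hB
    rw [hx _ (isLb_indicator hB), integral_indicator_const _ hB]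
    simp [ofReal_measureReal]
  have hnn : ∀ t x (B : Set X), MeasurableSet B → 0 ≤ T t (B.indicator fun _ => 1) x := by
    intro t x B hB
    have := (hT.sublinear t x).mono _ _ (isLb_indicator hB)
      (⟨measurable_const, 0, by simp⟩ : IsLb fun _ : X => (0 : ℝ))
      fun y => Set.indicator_nonneg (fun _ _ => zero_le_one) y
    rwa [(hT.sublinear t x).const 0] at this
  have hinv : ∀ t, (κ t).Invariant μ := by
    intro t
    rw [Kernel.Invariant]
    ext B hB
    rw [Measure.bind_apply hB (κ t).aemeasurable]
    have h1 : ∫⁻ x, κ t x B ∂μ = ∫⁻ x, ENNReal.ofReal (T t (B.indicator fun _ => 1) x) ∂μ :=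
      lintegral_congr_ae (by filter_upwards [hval t] with x hx; exact hx B hB)
    have hLb := hT.maps t _ (isLb_indicator hB)
    rw [h1, ← ofReal_integral_eq_lintegral_ofReal (hLb.integrable μ)
      (.of_forall fun x => hnn t x B hB), ← hμ _ hLb, hT'.invariant t _ (isLb_indicator hB),
      hμ _ (isLb_indicator hB), integral_indicator_const _ hB]
    simp [ofReal_measureReal]
  refine ⟨inferInstance, hκ, hinv, fun s t => ?_⟩
  have hst : ∀ᵐ x ∂μ, ∀ᵐ y ∂(κ s x), ∀ B, MeasurableSet B →
      κ t y B = ENNReal.ofReal (T t (B.indicator fun _ => 1) y) := by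
    have h1 := hval t
    rw [← (hinv s).def] at h1
    exact Measure.ae_ae_of_ae_comp h1
  filter_upwards [hst, hval (s + t), hκT s] with x h1 h2 h3
  ext B hB
  have hLb := hT.maps t _ (isLb_indicator hB)
  rw [Kernel.comp_apply' _ _ _ hB, h2 B hB, ← hT.comp s t _ (isLb_indicator hB), h3 _ hLb,
    ofReal_integral_eq_lintegral_ofReal (hLb.integrable _) (.of_forall fun y => hnn t y B hB)]
  exact lintegral_congr_ae (by filter_upwards [h1] with y hy; exact hy B hB)

end Kernel

/-! ### The canonical expectation and ergodicity -/

section Canonical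

variable {X : Type*} [MeasurableSpace X] {T : ℝ≥0 → (X → ℝ) → X → ℝ} {T' : (X → ℝ) → ℝ}
  {κ : ℝ≥0 → Kernel X X} {μ : Measure X} {P : Measure (ℝ → X)}

lemma measurable_snoc (k : ℕ) : Measurable fun p : (Fin (k + 1) → X) × X =>
    (Fin.snoc (α := fun _ => X) p.1 p.2 : Fin (k + 2) → X) := by
  refine measurable_pi_lambda _ fun i => ?_
  refine Fin.lastCases ?_ (fun j => ?_) i
  · simpa using measurable_snd
  · simp only [Fin.snoc_castSucc]
    exact (measurable_pi_apply j).comp measurable_fst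

lemma isLb_section {k : ℕ} {φ : (Fin (k + 2) → X) → ℝ} (hφ : IsLb φ) (x : Fin (k + 1) → X) :
    IsLb fun y => φ (Fin.snoc (α := fun _ => X) x y) :=
  ⟨hφ.1.comp ((measurable_snoc k).comp measurable_prodMk_left), hφ.2.imp fun _ hC _ => hC _⟩

lemma isLb_step (hT : IsSublinearMarkovSemigroup T) (hTmeas : HasMeasurableSteps T) {k : ℕ}
    (t : ℝ≥0) {φ : (Fin (k + 2) → X) → ℝ} (hφ : IsLb φ) : IsLb (step T k t φ) := by
  refine ⟨hTmeas k t φ hφ, ?_⟩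
  obtain ⟨C, hC⟩ := hφ.2
  refine ⟨C, fun x => ?_⟩
  have hsub := hT.sublinear t (x (Fin.last k))
  have hconst : ∀ c : ℝ, IsLb fun _ : X => c := fun c => ⟨measurable_const, |c|, fun _ => le_rfl⟩
  have hup := hsub.mono _ _ (hconst C) (isLb_section hφ x) fun y => (abs_le.1 (hC _)).2
  have hlow := hsub.mono _ _ (isLb_section hφ x) (hconst (-C)) fun y => (abs_le.1 (hC _)).1
  rw [hsub.const] at hup hlow
  exact abs_le.2 ⟨hlow, hup⟩

/-- The finite-dimensional distributions of the nonlinear semigroup are those of the chain. -/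
lemma IsChainLaw.finDimExp_eq (hT : IsSublinearMarkovSemigroup T) (hTmeas : HasMeasurableSteps T)
    (hμ : ∀ φ, IsLb φ → T' φ = ∫ x, φ x ∂μ) (h : IsStationaryFamily κ μ)
    (hκT : ∀ t, ∀ᵐ x ∂μ, ∀ φ, IsLb φ → T t φ x = ∫ y, φ y ∂(κ t x))
    (hP : IsChainLaw κ μ P) (m : ℕ) {t : Fin (m + 1) → ℝ} (ht : StrictMono t)
    {φ : (Fin (m + 1) → X) → ℝ} (hφ : IsLb φ) :
    finDimExp T T' m t φ = ∫ ω, φ (fun i => ω (t i)) ∂P := by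
  have := hP.isProbabilityMeasure
  have := h.prob
  have := h.markov
  induction m with
  | zero =>
    have hconst : Measurable fun x : X => (fun _ : Fin 1 => x) :=
      measurable_pi_lambda _ fun _ => measurable_id
    have hLb : IsLb fun x : X => φ fun _ => x := ⟨hφ.1.comp hconst, hφ.2.imp fun _ hC _ => hC _⟩
    have hfun : ∀ ω : ℝ → X, (fun i => ω (t i)) = fun _ : Fin 1 => ω (t 0) := fun ω => by
      ext i; rw [Fin.fin_one_eq_zero i]
    simp only [finDimExp, hfun]
    rw [hμ _ hLb, ← hP.map_eval (t 0),
      integral_map (measurable_pi_apply _).aemeasurable hLb.1.aestronglyMeasurable]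
  | succ m ih =>
    set r := t (Fin.last m).castSucc
    set u := t (Fin.last (m + 1))
    have hru : r < u := ht (Fin.castSucc_lt_last _)
    have ht' : StrictMono fun i : Fin (m + 1) => t i.castSucc :=
      ht.comp Fin.strictMono_castSucc
    let Z : (ℝ → X) → Fin (m + 1) → X := fun ω i => ω (t i.castSucc)
    have hZ : Measurable[cylinderEvents (X := fun _ : ℝ => X) (Set.Iic r)] Z := by
      refine @measurable_pi_lambda _ _ _ (_) _ _ fun i => ?_
      exact measurable_cylinderEvent_apply (Set.mem_Iic.2 (ht'.monotone (Fin.le_last i)))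
    have hZ' : Measurable Z := hZ.mono cylinderEvents_le_pi le_rfl
    have hmap := hP.map_prodMk h hru hZ (measurable_pi_apply (Fin.last m)) fun ω => rfl
    have hm : Measurable fun ω : ℝ → X => (Z ω, ω u) := hZ'.prodMk (measurable_pi_apply u)
    have hprob := Measure.isProbabilityMeasure_map (μ := P) hZ'.aemeasurable
    have hφs : Measurable fun p : (Fin (m + 1) → X) × X =>
      φ (Fin.snoc (α := fun _ => X) p.1 p.2) := hφ.1.comp (measurable_snoc m)
    have hLb := isLb_step hT hTmeas (u - r).toNNReal hφ
    have hstep : ∀ᵐ z ∂(P.map Z), step T m (u - r).toNNReal φ z =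
        ∫ y, φ (Fin.snoc (α := fun _ => X) z y) ∂(κ (u - r).toNNReal (z (Fin.last m))) := by
      have h1 : ∀ᵐ x ∂((P.map Z).map fun z => z (Fin.last m)), ∀ φ, IsLb φ →
          T (u - r).toNNReal φ x = ∫ y, φ y ∂(κ (u - r).toNNReal x) := by
        rw [Measure.map_map (measurable_pi_apply _) hZ']
        have := hP.map_eval r
        exact this.symm ▸ hκT (u - r).toNNReal
      filter_upwards [ae_of_ae_map (measurable_pi_apply _).aemeasurable h1] with z hz
      exact hz _ (isLb_section hφ z)
    have hsnoc : ∀ ω : ℝ → X, (Fin.snoc (α := fun _ => X) (Z ω) (ω u) : Fin (m + 2) → X) =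
        fun i => ω (t i) := fun ω => by
      ext i
      refine Fin.lastCases ?_ (fun j => ?_) i
      · simp [u]
      · simp [Z]
    have hint : Integrable (fun p : (Fin (m + 1) → X) × X =>
        φ (Fin.snoc (α := fun _ => X) p.1 p.2)) ((P.map Z) ⊗ₘ ((κ (u - r).toNNReal).comap
          (fun z : Fin (m + 1) → X => z (Fin.last m)) (measurable_pi_apply _))) :=
      IsLb.integrable ⟨hφs, hφ.2.imp fun _ hC _ => hC _⟩ _
    calc finDimExp T T' (m + 1) t φ
        = ∫ ω, step T m (u - r).toNNReal φ (Z ω) ∂P := ih ht' hLb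
      _ = ∫ z, step T m (u - r).toNNReal φ z ∂(P.map Z) :=
          (integral_map hZ'.aemeasurable hLb.1.aestronglyMeasurable).symm
      _ = ∫ z, ∫ y, φ (Fin.snoc (α := fun _ => X) z y)
            ∂(κ (u - r).toNNReal (z (Fin.last m))) ∂(P.map Z) := integral_congr_ae hstep
      _ = ∫ p, φ (Fin.snoc (α := fun _ => X) p.1 p.2) ∂(P.map fun ω => (Z ω, ω u)) := by
          rw [hmap, Measure.integral_compProd hint]
          rfl
      _ = ∫ ω, φ (fun i => ω (t i)) ∂P := by
          rw [integral_map hm.aemeasurable hφs.aestronglyMeasurable]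
          simp only [hsnoc]

/-- A probability measure on path space that is dominated by the finite-dimensional distributions
of `P` is `P`, as domination applies to `φ` and `-φ`. -/
lemma eq_of_forall_integral_le {Q : Measure (ℝ → X)} [IsProbabilityMeasure P]
    [IsProbabilityMeasure Q]
    (hQ : ∀ (m : ℕ) (t : Fin (m + 1) → ℝ), StrictMono t → ∀ φ : (Fin (m + 1) → X) → ℝ, IsLb φ →
      ∫ ω, φ (fun i => ω (t i)) ∂Q ≤ ∫ ω, φ (fun i => ω (t i)) ∂P) : Q = P := by
  have hgen := generateFrom_boxes (X := X) Set.univ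
  rw [cylinderEvents_univ] at hgen
  refine ext_of_generate_finite _ hgen (isPiSystem_boxes _) (fun s hs => ?_) (by simp)
  obtain ⟨J, B, -, hB, rfl⟩ := exists_of_mem_boxes hs
  rcases J.eq_empty_or_nonempty with rfl | hJ
  · simp
  obtain ⟨m, hm⟩ := Nat.exists_eq_succ_of_ne_zero hJ.card_pos.ne'
  let t := J.orderEmbOfFin hm
  let R : Set (Fin (m + 1) → X) := {z | ∀ i, z i ∈ B (t i)}
  have hR : MeasurableSet R := by
    have : R = ⋂ i, (fun z => z i) ⁻¹' B (t i) := by ext z; simp [R]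
    rw [this]
    exact MeasurableSet.iInter fun i => measurable_pi_apply i (hB _)
  have hset : {ω : ℝ → X | ∀ s ∈ J, ω s ∈ B s} = (fun ω i => ω (t i)) ⁻¹' R := by
    ext ω
    simp only [Set.mem_ofPred_eq, Set.mem_preimage, R]
    constructor
    · exact fun h i => h _ (J.orderEmbOfFin_mem hm i)
    · intro h s hs
      rw [← Finset.mem_coe, ← J.range_orderEmbOfFin hm] at hs
      obtain ⟨i, rfl⟩ := hs
      exact h i
  have hmeas : Measurable fun (ω : ℝ → X) i => ω (t i) :=
    measurable_pi_lambda _ fun i => measurable_pi_apply _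
  have hval : ∀ (Q' : Measure (ℝ → X)) [IsProbabilityMeasure Q'],
      ∫ ω, R.indicator (fun _ => (1 : ℝ)) (fun i => ω (t i)) ∂Q' =
        Q'.real ((fun ω i => ω (t i)) ⁻¹' R) := by
    intro Q' _
    have : ∀ ω : ℝ → X, R.indicator (fun _ => (1 : ℝ)) (fun i => ω (t i)) =
      ((fun ω i => ω (t i)) ⁻¹' R).indicator (fun _ => (1 : ℝ)) ω := fun ω => rfl
    simp only [this]
    rw [integral_indicator_const _ (hmeas hR)]
    simp
  have h1 := hQ m t t.strictMono _ (isLb_indicator hR)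
  have h2 := hQ m t t.strictMono _ (isLb_indicator hR).neg
  rw [integral_neg, integral_neg] at h2
  rw [hval, hval] at h1 h2
  rw [hset, ← measureReal_eq_measureReal_iff]
  linarith

/-- The law of the chain is the only canonical prior. -/
lemma IsChainLaw.canonicalExp_eq (hT : IsSublinearMarkovSemigroup T)
    (hTmeas : HasMeasurableSteps T)
    (hμ : ∀ φ, IsLb φ → T' φ = ∫ x, φ x ∂μ) (h : IsStationaryFamily κ μ)
    (hκT : ∀ t, ∀ᵐ x ∂μ, ∀ φ, IsLb φ → T t φ x = ∫ y, φ y ∂(κ t x))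
    (hP : IsChainLaw κ μ P) (ξ : (ℝ → X) → ℝ) : canonicalExp T T' ξ = ∫ ω, ξ ω ∂P := by
  have hprob := hP.isProbabilityMeasure
  have hfd := fun m {t : Fin (m + 1) → ℝ} ht {φ} hφ =>
    hP.finDimExp_eq hT hTmeas hμ h hκT m (t := t) ht (φ := φ) hφ
  obtain ⟨P₀, rfl⟩ : ∃ P₀ : ProbabilityMeasure (ℝ → X), (P₀ : Measure (ℝ → X)) = P :=
    ⟨⟨P, hprob⟩, rfl⟩
  have hset : canonicalPriors T T' = {P₀} := by
    refine Set.eq_singleton_iff_unique_mem.2 ⟨fun m t ht φ hφ => (hfd m ht hφ).ge, ?_⟩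
    intro Q hQ
    have heq : (Q : Measure (ℝ → X)) = P₀ :=
      eq_of_forall_integral_le fun m t ht φ hφ => (hQ m t ht φ hφ).trans_eq (hfd m ht hφ)
    exact Subtype.ext heq
  rw [canonicalExp, hset, Set.image_singleton, csSup_singleton]

lemma IsChainLaw.holdsAS_canonicalExp_iff (hP : IsChainLaw κ μ P)
    (hE : ∀ ξ, canonicalExp T T' ξ = ∫ ω, ξ ω ∂P) {p : (ℝ → X) → Prop} :
    HoldsAS (canonicalExp T T') p ↔ ∀ᵐ ω ∂P, p ω :=
  have := hP.isProbabilityMeasure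
  holdsAS_iff fun ξ _ => hE ξ

lemma IsChainLaw.isInvariantSet_iff (hP : IsChainLaw κ μ P)
    (hE : ∀ ξ, canonicalExp T T' ξ = ∫ ω, ξ ω ∂P) {A : Set (ℝ → X)} :
    IsInvariantSet T T' A ↔ MeasurableSet A ∧ ∀ t : ℝ, shift t ⁻¹' A =ᵐ[P] A := by
  refine and_congr_right fun _ => forall_congr' fun t => ?_
  rw [hP.holdsAS_canonicalExp_iff hE, eventuallyEq_set]
  refine eventually_congr (.of_forall fun ω => ?_)
  by_cases h1 : shift t ω ∈ A <;> by_cases h2 : ω ∈ A <;> simp [h1, h2]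

lemma IsChainLaw.canonicalExp_indicator_eq_zero_iff (hP : IsChainLaw κ μ P)
    (hE : ∀ ξ, canonicalExp T T' ξ = ∫ ω, ξ ω ∂P) {A : Set (ℝ → X)} (hA : MeasurableSet A) :
    canonicalExp T T' (A.indicator fun _ => 1) = 0 ↔ P A = 0 := by
  have := hP.isProbabilityMeasure
  rw [hE, integral_indicator_const _ hA]
  simp [measureReal_eq_zero_iff]

/-- The ergodicity criterion for the semigroup once it is known to be given by Markov kernels. -/
theorem isErgodic_iff_of_kernel [TopologicalSpace X] [PolishSpace X] [BorelSpace X]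
    (hT : IsSublinearMarkovSemigroup T) (hTmeas : HasMeasurableSteps T)
    (hμ : ∀ φ, IsLb φ → T' φ = ∫ x, φ x ∂μ) (h : IsStationaryFamily κ μ)
    (hκT : ∀ t, ∀ᵐ x ∂μ, ∀ φ, IsLb φ → T t φ x = ∫ y, φ y ∂(κ t x)) :
    IsErgodic T T' ↔ ∀ φ : X → ℝ, IsLb φ →
      (∀ t : ℝ≥0, HoldsAS T' (fun x => T t φ x = φ x) ∧
        HoldsAS T' (fun x => T t (fun y => -φ y) x = -φ x)) →
      ∃ c : ℝ, HoldsAS T' (fun x => φ x = c) := by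
  obtain ⟨P, hP⟩ := exists_isChainLaw h
  have := h.prob
  have := h.markov
  have hprob := hP.isProbabilityMeasure
  have hE := hP.canonicalExp_eq hT hTmeas hμ h hκT
  have hmu : ∀ {B : Set X}, MeasurableSet B → P {ω | ω 0 ∈ B} = μ B := fun {B} hB => by
    rw [← hP.map_eval 0, Measure.map_apply (measurable_pi_apply 0) hB]
    rfl
  simp only [holdsAS_iff hμ]
  constructor
  · intro herg φ hφ hinv
    have hharm : ∀ t : ℝ≥0, ∀ᵐ x ∂μ, ∫ y, φ y ∂(κ t x) = φ x := fun t => by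
      filter_upwards [(hinv t).1, hκT t] with x h1 h2
      rw [← h2 φ hφ, h1]
    refine exists_eventuallyEq_const_of_forall_separating (l := ae μ) MeasurableSet fun U hU => ?_
    have hUm : MeasurableSet (φ ⁻¹' U) := hφ.1 hU
    have hA : MeasurableSet {ω : ℝ → X | ω 0 ∈ φ ⁻¹' U} := measurable_pi_apply 0 hUm
    have hAinv : IsInvariantSet T T' {ω : ℝ → X | ω 0 ∈ φ ⁻¹' U} := by
      refine (hP.isInvariantSet_iff hE).2 ⟨hA, fun t => eventuallyEq_set.2 ?_⟩
      filter_upwards [hP.ae_eq_of_harmonic_all h hφ hharm t] with ω hω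
      change φ (ω (t + 0)) ∈ U ↔ φ (ω 0) ∈ U
      rw [add_zero, hω]
    rcases herg _ hAinv with h0 | h0
    · rw [hP.canonicalExp_indicator_eq_zero_iff hE hA, hmu hUm] at h0
      exact .inr (measure_eq_zero_iff_ae_notMem.1 h0)
    · rw [hP.canonicalExp_indicator_eq_zero_iff hE hA.compl] at h0
      have h0' : μ (φ ⁻¹' U)ᶜ = 0 := (hmu hUm.compl).symm.trans h0
      exact .inl (mem_ae_iff.2 h0')
  · intro hconst A hAinv
    obtain ⟨hA, hinv⟩ := (hP.isInvariantSet_iff hE).1 hAinv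
    obtain ⟨B, hB, hAB⟩ := hP.exists_eq_present hA hinv
    have hφ : IsLb (B.indicator fun _ => (1 : ℝ)) := isLb_indicator hB
    obtain ⟨c, hc⟩ := hconst _ hφ fun t => by
      rcases eq_or_lt_of_le (zero_le : 0 ≤ t) with rfl | ht
      · rw [hT.zero _ hφ, hT.zero _ hφ.neg]
        exact ⟨.of_forall fun _ => rfl, .of_forall fun _ => rfl⟩
      · have hmem := hP.ae_mem_iff_of_invariant h hinv hB hAB ht
        have hval : ∀ᵐ x ∂μ, ∫ y, B.indicator (fun _ => (1 : ℝ)) y ∂(κ t x) =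
            B.indicator (fun _ => (1 : ℝ)) x := by
          filter_upwards [hmem] with x hx
          have : (fun y => B.indicator (fun _ => (1 : ℝ)) y) =ᵐ[κ t x]
              fun _ => B.indicator (fun _ => (1 : ℝ)) x := by
            filter_upwards [hx] with y hy
            by_cases h1 : x ∈ B <;> simp [h1, hy]
          rw [integral_congr_ae this]
          simp
        constructor
        · filter_upwards [hκT t, hval] with x h1 h2
          rw [h1 _ hφ, h2]
        · filter_upwards [hκT t, hval] with x h1 h2
          rw [h1 _ hφ.neg, integral_neg, h2]
    rw [hP.canonicalExp_indicator_eq_zero_iff hE hA,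
      hP.canonicalExp_indicator_eq_zero_iff hE hA.compl, measure_congr hAB,
      measure_congr hAB.compl, hmu hB]
    by_cases h1 : c = 1
    · right
      refine (hmu hB.compl).trans (measure_eq_zero_iff_ae_notMem.2 ?_)
      filter_upwards [hc] with x hx hxB
      simp [Set.indicator_of_notMem hxB, h1] at hx
    · left
      refine measure_eq_zero_iff_ae_notMem.2 ?_
      filter_upwards [hc] with x hx hxB
      rw [Set.indicator_of_mem hxB] at hx
      exact h1 hx.symm

/-- The absence of mean-uncertainty, applied to indicators, makes `T'` linear. -/
lemma exists_eq_integral_of_mean (hT'rep : IsUpperExpectation T')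
    (hmean : ∀ φ : X → ℝ, IsLb φ →
      finDimExp T T' 0 (fun _ => 0) (fun x => |φ (x 0)| ^ 2) =
        -finDimExp T T' 0 (fun _ => 0) (fun x => -(|φ (x 0)| ^ 2))) :
    ∃ μ : Measure X, IsProbabilityMeasure μ ∧ ∀ φ, IsLb φ → T' φ = ∫ x, φ x ∂μ := by
  obtain ⟨Q, hQ⟩ := hT'rep.exists_eq_integral (C := {s | MeasurableSet s})
    MeasurableSpace.generateFrom_measurableSet.symm MeasurableSpace.isPiSystem_measurableSet
    fun s hs => by
      have hsq : ∀ x, |s.indicator (fun _ => (1 : ℝ)) x| ^ 2 = s.indicator (fun _ => (1 : ℝ)) x :=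
        fun x => by by_cases hx : x ∈ s <;> simp [hx]
      have := hmean _ (isLb_indicator hs)
      simpa only [finDimExp, hsq] using this
  exact ⟨Q, inferInstance, hQ⟩

end Canonical

end SublinearErgodic

theorem mainTheorem5 (d : ℕ)
    (T : ℝ≥0 → (EuclideanSpace ℝ (Fin d) → ℝ) → EuclideanSpace ℝ (Fin d) → ℝ)
    (T' : (EuclideanSpace ℝ (Fin d) → ℝ) → ℝ)
    (hT : SublinearErgodic.IsSublinearMarkovSemigroup T)
    (hTrep : ∀ t x, SublinearErgodic.IsUpperExpectation (fun φ => T t φ x))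
    (hTmeas : SublinearErgodic.HasMeasurableSteps T)
    (hT' : SublinearErgodic.IsInvariantExpectation T T')
    (hT'rep : SublinearErgodic.IsUpperExpectation T')
    (hmean : ∀ φ : EuclideanSpace ℝ (Fin d) → ℝ, SublinearErgodic.IsLb φ →
      SublinearErgodic.finDimExp T T' 0 (fun _ => 0) (fun x => |φ (x 0)| ^ 2) =
        -SublinearErgodic.finDimExp T T' 0 (fun _ => 0) (fun x => -(|φ (x 0)| ^ 2))) :
    SublinearErgodic.IsErgodic T T' ↔
      ∀ φ : EuclideanSpace ℝ (Fin d) → ℝ, SublinearErgodic.IsLb φ →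
        (∀ t : ℝ≥0, SublinearErgodic.HoldsAS T' (fun x => T t φ x = φ x) ∧
          SublinearErgodic.HoldsAS T' (fun x => T t (fun y => -φ y) x = -φ x)) →
        ∃ c : ℝ, SublinearErgodic.HoldsAS T' (fun x => φ x = c) := by
  obtain ⟨μ, hprob, hμ⟩ := SublinearErgodic.exists_eq_integral_of_mean hT'rep hmean
  choose κ hκ hκT using SublinearErgodic.exists_kernel hT hTrep hT' hμ
  exact SublinearErgodic.isErgodic_iff_of_kernel hT hTmeas hμ
    (SublinearErgodic.isStationaryFamily_of_semigroup hT hT' hμ hκ hκT) hκT
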